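/- Let $d\ge 1$ and let $k(\mathbf x,\mathbf x')=\prod_{j=1}^d p_j(x_j\wedge x_j')\,q_j(x_j\vee x_j')$, $\mathbf x,\mathbf x'\in(0,1)^d$, be a tensor Markov (TM) kernel: $p_j,q_j>0$ on $(0,1)$ and $p_j/q_j$ is strictly increasing. Assume that, for each $j$, $p_j$ and $q_j$ are continuously differentiable and both solve $(u_jf')'+v_jf=0$ on $(0,1)$ for some $u_j\in C^1(0,1)$ and $v_j\in C(0,1)$. Notation. Let $\mathsf c_{l,i}=i2^{-l}$, and $\mathbf c_{\mathbf l,\mathbf i}=(\mathsf c_{l_1,i_1},\dots,\mathsf c_{l_d,i_d})$ for $\mathbf l\in\mathbb N^d$ (all $l_j\ge1$) and $\mathbf i$ with every $i_j$ odd and $1\le i_j\le 2^{l_j}-1$; all pairs $(\mathbf l,\mathbf i)$ below are of this kind. Let $\mathcal X_\tau=\bigcup_{|\mathbf l|\le\tau+d-1}\prod_{j}\{i2^{-l_j}:1\le i\le 2^{l_j}-1\}$, $|\mathbf l|=\sum_j l_j$, be the classical sparse grid of level $\tau$. A truncated sparse grid of size $n$ is a set $\mathcal X_\tau\cup\mathcal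 A$ with $\tau\ge1$, $|\mathcal X_\tau|\le n<|\mathcal X_{\tau+1}|$, $\mathcal A\subseteq\mathcal X_{\tau+1}\setminus\mathcal X_\tau$ and $|\mathcal A|=\tilde n:=n-|\mathcal X_\tau|$. Put $\mathsf p_{j,l,i}=p_j(\mathsf c_{l,i})$ and $\mathsf q_{j,l,i}=q_j(\mathsf c_{l,i})$ for $1\le i\le 2^l-1$, with the boundary convention $\mathsf p_{j,l,0}=\mathsf q_{j,l,2^l}=0$, $\mathsf p_{j,l,2^l}=\mathsf q_{j,l,0}=1$. Let $\phi_{\mathbf l,\mathbf i}(\mathbf x)=\prod_j\phi_{j,l_j,i_j}(x_j)$, where $$\phi_{j,l,i}(x)=\frac{p_j(x)\mathsf q_{j,l,i-1}-\mathsf p_{j,l,i-1}q_j(x)}{\mathsf p_{j,l,i}\mathsf q_{j,l,i-1}-\mathsf p_{j,l,i-1}\mathsf q_{j,l,i}}\ \text{ on }(\mathsf c_{l,i-1},\mathsf c_{l,i}],\qquad \phi_{j,l,i}(x)=\frac{\mathsf p_{j,l,i+1}q_j(x)-p_j(x)\mathsf q_{j,l,i+1}}{\mathsf p_{j,l,i+1}\mathsf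 q_{j,l,i}-\mathsf p_{j,l,i}\mathsf q_{j,l,i+1}}\ \text{ on }(\mathsf c_{l,i},\mathsf c_{l,i+1}),$$ and $\phi_{j,l,i}=0$ elsewhere. Let $\mathcal R_{\mathbf l,\mathbf i}=\prod_j(\mathsf c_{l_j,i_j-1},\mathsf c_{l_j,i_j+1})$. Theorem. There is a constant $C$ that does not depend on $n,\tau,\mathcal A$ such that the following holds for every truncated sparse grid $\mathcal X_\tau\cup\mathcal A$ of size $n\ge3$ with kernel matrix $\mathbf K=k(\mathcal X_\tau\cup\mathcal A,\mathcal X_\tau\cup\mathcal A)$. (i) $\mathbf A=k(\mathcal X_\tau,\mathcal X_\tau)$ and $\mathbf K$ are invertible, and $$\mathbf K^{-1}=\begin{pmatrix}\mathbf E&-\mathbf B\mathbf D\\-\mathbf D\mathbf B^{\intercal}&\mathbf D\end{pmatrix},\qquad \mathbf B=\mathbf A^{-1}k(\mathcal X_\tau,\mathcal A),\quad \mathbf E=\mathbf A^{-1}+\mathbf B\mathbf D\mathbf B^{\intercal},$$ with blocks of sizes $|\mathcal X_\tau|$ and $\tilde n$, where $\mathbf D$ is diagonal and, for all $(\mathbf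 l,\mathbf i)$ with $\mathbf c_{\mathbf l,\mathbf i}\in\mathcal A$, $$\mathbf D_{(\mathbf l,\mathbf i),(\mathbf l,\mathbf i)}=\prod_{j=1}^d\frac{\mathsf p_{j,l_j,i_j+1}\mathsf q_{j,l_j,i_j-1}-\mathsf p_{j,l_j,i_j-1}\mathsf q_{j,l_j,i_j+1}}{(\mathsf p_{j,l_j,i_j}\mathsf q_{j,l_j,i_j-1}-\mathsf p_{j,l_j,i_j-1}\mathsf q_{j,l_j,i_j})(\mathsf p_{j,l_j,i_j+1}\mathsf q_{j,l_j,i_j}-\mathsf p_{j,l_j,i_j}\mathsf q_{j,l_j,i_j+1})}=\|\phi_{\mathbf l,\mathbf i}\|_{\mathscr H_k}^2,$$ where $\mathscr H_k$ is the reproducing kernel Hilbert space of $k$ on $(0,1)^d$, which contains $\phi_{\mathbf l,\mathbf i}$. (ii) $(\mathbf K^{-1})_{(\mathbf l',\mathbf i'),(\mathbf l'',\mathbf i'')}=(\mathbf K^{-1})_{(\mathbf l'',\mathbf i''),(\mathbf l',\mathbf i')}=0$ whenever one of the following holds: (a) $\mathbf c_{\mathbf l',\mathbf i'},\mathbf c_{\mathbf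 l'',\mathbf i''}\in\mathcal A$ and $\mathbf c_{\mathbf l',\mathbf i'}\ne\mathbf c_{\mathbf l'',\mathbf i''}$; (b) $\mathbf c_{\mathbf l',\mathbf i'}\in\mathcal X_\tau$, $\mathbf c_{\mathbf l'',\mathbf i''}\in\mathcal A$ and $\mathbf c_{\mathbf l'',\mathbf i''}\notin\mathcal R_{\mathbf l',\mathbf i'}$; (c) $\mathbf c_{\mathbf l',\mathbf i'},\mathbf c_{\mathbf l'',\mathbf i''}\in\mathcal X_\tau$, $\bigl|i_j'2^{l_j'\vee l_j''-l_j'}-i_j''2^{l_j'\vee l_j''-l_j''}\bigr|\ge2$ for some $j$, and no point of $\mathcal A$ lies in $\mathcal R_{\mathbf l',\mathbf i'}\cap\mathcal R_{\mathbf l'',\mathbf i''}$. (iii) The number of nonzero entries of $\mathbf E$ is at most $C(|\mathcal X_\tau|+\tilde n\tau^{2d})$; if $\tau\ge2$, that of $\mathbf B\mathbf D$ is at most $C\,\tilde n\,(\log|\mathcal X_\tau|)^{d-1}$; and the proportion of nonzero entries of $\mathbf K^{-1}$ is at most $C\,n^{-1}(\log n)^{2d}$. -/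

import Mathlib

noncomputable section

/-! ### Tensor Markov kernels on the open unit cube -/

/-- `p`, `q` are the factors of a tensor Markov kernel on `(0,1)^d`: positive functions on `(0,1)`
with `p j / q j` strictly increasing. -/
structure IsTMPair {d : ℕ} (p q : Fin d → ℝ → ℝ) : Prop where
  p_pos : ∀ j, ∀ x ∈ Set.Ioo (0 : ℝ) 1, 0 < p j x
  q_pos : ∀ j, ∀ x ∈ Set.Ioo (0 : ℝ) 1, 0 < q j x
  ratio_strictMono : ∀ j, StrictMonoOn (fun x => p j x / q j x) (Set.Ioo (0 : ℝ) 1)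

/-- `f` solves `(u f')' + v f = 0` on `(0,1)`. -/
def SolvesSL (u v f : ℝ → ℝ) : Prop :=
  ∀ x ∈ Set.Ioo (0 : ℝ) 1, HasDerivAt (fun y => u y * deriv f y) (-(v x * f x)) x

/-- For each coordinate, `p j` and `q j` are continuously differentiable on `(0,1)` and solve a
common Sturm–Liouville equation with `u` continuously differentiable and `v` continuous. -/
def SatisfiesSL {d : ℕ} (p q : Fin d → ℝ → ℝ) : Prop :=
  ∀ j, ContDiffOn ℝ 1 (p j) (Set.Ioo (0 : ℝ) 1) ∧ ContDiffOn ℝ 1 (q j) (Set.Ioo (0 : ℝ) 1) ∧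
    ∃ u v : ℝ → ℝ, ContDiffOn ℝ 1 u (Set.Ioo (0 : ℝ) 1) ∧ ContinuousOn v (Set.Ioo (0 : ℝ) 1) ∧
      SolvesSL u v (p j) ∧ SolvesSL u v (q j)

/-- `k(x,y) = ∏ⱼ pⱼ(xⱼ ∧ yⱼ) qⱼ(xⱼ ∨ yⱼ)`. -/
def tmKernel {d : ℕ} (p q : Fin d → ℝ → ℝ) (x y : Fin d → ℝ) : ℝ :=
  ∏ j, p j (min (x j) (y j)) * q j (max (x j) (y j))

/-- The matrix `k(S, T)` of kernel values for two finite sets of points. -/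
def kernelMatrix {d : ℕ} (p q : Fin d → ℝ → ℝ) (S T : Finset (Fin d → ℝ)) : Matrix S T ℝ :=
  Matrix.of fun x y => tmKernel p q x y

/-! ### Sparse grids -/

/-- The dyadic node `i · 2^{-l}`. -/
def node (l i : ℕ) : ℝ := (i : ℝ) / 2 ^ l

/-- The one-dimensional dyadic design `{i · 2^{-l} : 1 ≤ i ≤ 2^l - 1}`. -/
def dyadicGrid (l : ℕ) : Finset ℝ := (Finset.Icc 1 (2 ^ l - 1)).image (node l)

/-- The classical sparse grid of level `τ`: the union of the lattices with levels
`l j ≥ 1` and `∑ j, l j ≤ τ + d - 1`. -/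
def sparseGrid (d τ : ℕ) : Finset (Fin d → ℝ) :=
  ((Fintype.piFinset fun _ : Fin d => Finset.Icc 1 (τ + d - 1)).filter
    fun l => ∑ j, l j ≤ τ + d - 1).biUnion
      fun l => Fintype.piFinset fun j => dyadicGrid (l j)

/-- `sparseGrid d τ ∪ A` is a truncated sparse grid of size `n`. -/
structure IsTSG {d : ℕ} (n τ : ℕ) (A : Finset (Fin d → ℝ)) : Prop where
  one_le_level : 1 ≤ τ
  card_le : (sparseGrid d τ).card ≤ n
  lt_card : n < (sparseGrid d (τ + 1)).card
  subset : A ⊆ sparseGrid d (τ + 1) \ sparseGrid d τ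
  card_add : (sparseGrid d τ).card + A.card = n

theorem IsTSG.disjoint {d n τ : ℕ} {A : Finset (Fin d → ℝ)} (h : IsTSG n τ A) :
    Disjoint (sparseGrid d τ) A :=
  Finset.disjoint_of_subset_right h.subset Finset.disjoint_sdiff

/-- Admissible indices for the level `l`: every `i j` is odd and lies between `1` and `2^{l j}`.
Since every odd number is at least `1`, this forces `l j ≥ 1`. -/
def IsIndex {d : ℕ} (l i : Fin d → ℕ) : Prop := ∀ j, Odd (i j) ∧ i j < 2 ^ l j

/-- The grid point with level `l` and index `i`. -/
def gridPoint {d : ℕ} (l i : Fin d → ℕ) : Fin d → ℝ := fun j => node (l j) (i j)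

/-- The open hyperrectangle `∏ⱼ ((i j - 1) 2^{-l j}, (i j + 1) 2^{-l j})`. -/
def hyperrect {d : ℕ} (l i : Fin d → ℕ) : Set (Fin d → ℝ) :=
  {x | ∀ j, x j ∈ Set.Ioo (node (l j) (i j - 1)) (node (l j) (i j + 1))}

/-! ### Basis functions -/

/-- Nodal values of `p` at level `l`. At the end points `0` and `1` of the design interval, where
the kernel is not defined, the values are `0` and `1`. -/
def pNode (p : ℝ → ℝ) (l i : ℕ) : ℝ := if i = 0 then 0 else if i = 2 ^ l then 1 else p (node l i)

/-- Nodal values of `q` at level `l`, with the values `1` and `0` at the end points. -/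
def qNode (q : ℝ → ℝ) (l i : ℕ) : ℝ := if i = 0 then 1 else if i = 2 ^ l then 0 else q (node l i)

/-- The quotient
`(p_{i+1} q_{i-1} - p_{i-1} q_{i+1}) / ((p_i q_{i-1} - p_{i-1} q_i) (p_{i+1} q_i - p_i q_{i+1}))`
of nodal values at level `l`. -/
def nodeRatio (p q : ℝ → ℝ) (l i : ℕ) : ℝ :=
  (pNode p l (i + 1) * qNode q l (i - 1) - pNode p l (i - 1) * qNode q l (i + 1)) /
    ((pNode p l i * qNode q l (i - 1) - pNode p l (i - 1) * qNode q l i) *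
      (pNode p l (i + 1) * qNode q l i - pNode p l i * qNode q l (i + 1)))

/-- The one-dimensional basis function with support around the node `i · 2^{-l}`. -/
def basisFun1 (p q : ℝ → ℝ) (l i : ℕ) (x : ℝ) : ℝ :=
  if x ∈ Set.Ioc (node l (i - 1)) (node l i) then
    (p x * qNode q l (i - 1) - pNode p l (i - 1) * q x) /
      (pNode p l i * qNode q l (i - 1) - pNode p l (i - 1) * qNode q l i)
  else if x ∈ Set.Ioo (node l i) (node l (i + 1)) then
    (pNode p l (i + 1) * q x - p x * qNode q l (i + 1)) /
      (pNode p l (i + 1) * qNode q l i - pNode p l i * qNode q l (i + 1))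
  else 0

/-- The tensor product basis function. -/
def basisFun {d : ℕ} (p q : Fin d → ℝ → ℝ) (l i : Fin d → ℕ) (x : Fin d → ℝ) : ℝ :=
  ∏ j, basisFun1 (p j) (q j) (l j) (i j) (x j)

/-- The open unit cube `(0,1)^d`. -/
abbrev UnitCube (d : ℕ) : Type := {x : Fin d → ℝ // ∀ j, x j ∈ Set.Ioo (0 : ℝ) 1}

/-- `H` is the reproducing kernel Hilbert space of the kernel on `(0,1)^d`. -/
def HasTMKernel {d : ℕ} (p q : Fin d → ℝ → ℝ) (H : Type*) [NormedAddCommGroup H]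
    [InnerProductSpace ℝ H] [CompleteSpace H] [RKHS ℝ H (UnitCube d) ℝ] : Prop :=
  ∀ x y : UnitCube d, RKHS.kernel H x y 1 = tmKernel p q x.1 y.1

/-! ### Counting nonzero entries -/

/-- The number of nonzero entries of a matrix. -/
def nnz {m n : Type*} [Fintype m] [Fintype n] (M : Matrix m n ℝ) : ℕ :=
  (Finset.univ.filter fun ij : m × n => M ij.1 ij.2 ≠ 0).card

/-- The proportion of nonzero entries of a matrix. -/
def density {m n : Type*} [Fintype m] [Fintype n] (M : Matrix m n ℝ) : ℝ :=
  (nnz M : ℝ) / ((Fintype.card m : ℝ) * (Fintype.card n : ℝ))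

end

/-!
Each basis function `φ_x` at a grid point `x` is a combination `∑ y, w_x(y) k(y, ·)` of the kernel
functions at the at most `3 ^ d` points of a stencil around `x`. In one dimension, a basis function
vanishes at the stencil of any other node of the same or a coarser level, so that the `φ_x` are
orthogonal. If a finite set `X` of grid points contains the stencils of its points, this says that
`W K Wᵀ = Δ`, where `W` is the matrix of the coefficients `w_x(y)`, `K` is the kernel matrix of `X`
and `Δ` is diagonal. Hence `K⁻¹ = Wᵀ Δ⁻¹ W`, and the entry of `K⁻¹` at `(y, z)` vanishes unless `y`
and `z` lie in the stencil of a common point of `X`. The points of the stencil of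
`x ∈ sparseGrid d (τ + 1)` other than `x` lie in `sparseGrid d τ`. So truncated sparse grids contain
the stencils of their points, and a point of `A` lies in no stencil but its own: its column in `K⁻¹`
consists of the coefficients of its basis function.
-/

noncomputable section

/-! ### Dyadic nodes -/

theorem node_strictMono (l : ℕ) : StrictMono (node l) := fun i j h => by
  unfold node
  gcongr

theorem node_zero (l : ℕ) : node l 0 = 0 := by simp [node]

theorem node_two_pow (l : ℕ) : node l (2 ^ l) = 1 := by simp [node]

theorem node_mem_Ioo {l i : ℕ} : node l i ∈ Set.Ioo (0 : ℝ) 1 ↔ 0 < i ∧ i < 2 ^ l := by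
  rw [Set.mem_Ioo, ← node_zero l, ← node_two_pow l, (node_strictMono l).lt_iff_lt,
    (node_strictMono l).lt_iff_lt]

theorem node_add_mul_two_pow (l k i : ℕ) : node (l + k) (i * 2 ^ k) = node l i := by
  unfold node
  push_cast
  rw [pow_add]
  field_simp

theorem node_pred {l i : ℕ} (hi : 0 < i) : node l (i - 1) = node l i - 1 / 2 ^ l := by
  rw [node, node, Nat.cast_pred hi, sub_div]

theorem node_succ (l i : ℕ) : node l (i + 1) = node l i + 1 / 2 ^ l := by
  rw [node, node, Nat.cast_succ, add_div]

theorem le_of_node_eq_node {l i m j : ℕ} (hi : Odd i) (h : node l i = node m j) : l ≤ m := by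
  by_contra! hlt
  obtain ⟨k, rfl⟩ := Nat.exists_eq_add_of_lt hlt
  rw [add_assoc, ← node_add_mul_two_pow m (k + 1) j] at h
  obtain rfl := (node_strictMono _).injective h
  exact Nat.not_even_iff_odd.2 hi ((even_two.pow_of_ne_zero k.succ_ne_zero).mul_left j)

theorem node_eq_node_iff_of_odd {l i m j : ℕ} (hi : Odd i) (hj : Odd j) :
    node l i = node m j ↔ l = m ∧ i = j := by
  refine ⟨fun h => ?_, by rintro ⟨rfl, rfl⟩; rfl⟩
  obtain rfl := le_antisymm (le_of_node_eq_node hi h) (le_of_node_eq_node hj h.symm)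
  exact ⟨rfl, (node_strictMono l).injective h⟩

theorem mem_dyadicGrid {l : ℕ} {x : ℝ} :
    x ∈ dyadicGrid l ↔ ∃ i, (0 < i ∧ i < 2 ^ l) ∧ node l i = x := by
  simp only [dyadicGrid, Finset.mem_image, Finset.mem_Icc, Nat.succ_le_iff,
    Nat.le_sub_one_iff_lt (Nat.two_pow_pos l)]

theorem mem_Ioo_of_mem_dyadicGrid {l : ℕ} {x : ℝ} (h : x ∈ dyadicGrid l) :
    x ∈ Set.Ioo (0 : ℝ) 1 := by
  obtain ⟨i, hi, rfl⟩ := mem_dyadicGrid.1 h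
  exact node_mem_Ioo.2 hi

theorem exists_odd_of_mem_dyadicGrid {m : ℕ} {x : ℝ} (h : x ∈ dyadicGrid m) :
    ∃ l i, (Odd i ∧ i < 2 ^ l) ∧ node l i = x := by
  obtain ⟨j, ⟨hj0, hjm⟩, rfl⟩ := mem_dyadicGrid.1 h
  obtain ⟨k, i, hi, rfl⟩ := Nat.exists_eq_two_pow_mul_odd hj0.ne'
  have hk : k < m := (Nat.pow_lt_pow_iff_right one_lt_two).1
    ((Nat.le_mul_of_pos_right _ hi.pos).trans_lt hjm)
  obtain ⟨l, rfl⟩ := Nat.exists_eq_add_of_le' hk.le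
  rw [mul_comm] at hjm ⊢
  exact ⟨l, i, ⟨hi, Nat.lt_of_mul_lt_mul_right (pow_add 2 l k ▸ hjm)⟩,
    (node_add_mul_two_pow l k i).symm⟩

theorem le_of_odd_of_node_mem_dyadicGrid {l i m : ℕ} (hi : Odd i) (h : node l i ∈ dyadicGrid m) :
    l ≤ m := by
  obtain ⟨j, -, hj⟩ := mem_dyadicGrid.1 h
  exact le_of_node_eq_node hi hj.symm

/-- The stencil of a node in one dimension: `i · 2^{-l}` and its two neighbours of level `l`, as far
as they lie in `(0,1)`. -/
def stencil1 (l i : ℕ) : Finset ℝ :=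
  (({i - 1, i, i + 1} : Finset ℕ).filter fun m => 0 < m ∧ m < 2 ^ l).image (node l)

theorem mem_stencil1 {l i : ℕ} {x : ℝ} :
    x ∈ stencil1 l i ↔
      ∃ m, ((m = i - 1 ∨ m = i ∨ m = i + 1) ∧ 0 < m ∧ m < 2 ^ l) ∧ node l m = x := by
  simp only [stencil1, Finset.mem_image, Finset.mem_filter, Finset.mem_insert,
    Finset.mem_singleton]

theorem card_stencil1_le (l i : ℕ) : (stencil1 l i).card ≤ 3 :=
  Finset.card_image_le.trans ((Finset.card_filter_le _ _).trans Finset.card_le_three)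

theorem stencil1_subset_dyadicGrid (l i : ℕ) : stencil1 l i ⊆ dyadicGrid l := by
  intro x hx
  obtain ⟨m, ⟨-, hm⟩, rfl⟩ := mem_stencil1.1 hx
  exact mem_dyadicGrid.2 ⟨m, hm, rfl⟩

theorem node_mem_stencil1 {l i : ℕ} (h0 : 0 < i) (h1 : i < 2 ^ l) : node l i ∈ stencil1 l i :=
  mem_stencil1.2 ⟨i, ⟨by simp, h0, h1⟩, rfl⟩

/-- The neighbours of an odd node have even indices. -/
theorem eq_node_or_mem_dyadicGrid_of_mem_stencil1 {l i : ℕ} (hi : Odd i) {x : ℝ}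
    (hx : x ∈ stencil1 l i) : x = node l i ∨ ∃ m < l, x ∈ dyadicGrid m := by
  obtain ⟨m, ⟨hm, hm0, hml⟩, rfl⟩ := mem_stencil1.1 hx
  rcases eq_or_ne m i with rfl | hmi
  · exact Or.inl rfl
  obtain ⟨k, rfl⟩ : ∃ k, m = k * 2 := by
    obtain ⟨r, rfl⟩ := hi
    exact ⟨m / 2, by omega⟩
  obtain _ | l := l
  · omega
  · exact Or.inr ⟨l, l.lt_succ_self, mem_dyadicGrid.2
      ⟨k, ⟨by omega, by omega⟩, (node_add_mul_two_pow l 1 k).symm⟩⟩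

theorem abs_sub_node_le_of_mem_stencil1 {l i : ℕ} {x : ℝ} (hx : x ∈ stencil1 l i) :
    |x - node l i| ≤ 1 / 2 ^ l := by
  obtain ⟨m, ⟨hm, hm0, -⟩, rfl⟩ := mem_stencil1.1 hx
  have hpos : (0 : ℝ) ≤ 1 / 2 ^ l := by positivity
  rcases hm with rfl | rfl | rfl
  · rw [node_pred (by omega), sub_sub_cancel_left, abs_neg, abs_of_nonneg hpos]
  · rwa [sub_self, abs_zero]
  · rw [node_succ, add_sub_cancel_left, abs_of_nonneg hpos]

theorem abs_node_sub_node_lt_of_mem_stencil1 {l i u v : ℕ} (hi : Odd i) (hv : Odd v)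
    (h : node l i ∈ stencil1 u v) : |node l i - node u v| < 1 / 2 ^ l := by
  rcases eq_node_or_mem_dyadicGrid_of_mem_stencil1 hv h with he | ⟨m, hmu, hm⟩
  · rw [he, sub_self, abs_zero]
    positivity
  · have hlu : l < u := (le_of_odd_of_node_mem_dyadicGrid hi hm).trans_lt hmu
    refine (abs_sub_node_le_of_mem_stencil1 h).trans_lt ?_
    gcongr
    exact one_lt_two

theorem node_mem_Ioo_of_mem_stencil1 {l i u v : ℕ} (hi : Odd i) (hv : Odd v)
    (h : node l i ∈ stencil1 u v) : node u v ∈ Set.Ioo (node l (i - 1)) (node l (i + 1)) := by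
  have hdist := abs_lt.1 (abs_node_sub_node_lt_of_mem_stencil1 hi hv h)
  rw [node_pred hi.pos, node_succ]
  constructor <;> linarith [hdist.1, hdist.2]

theorem abs_sub_lt_two_of_mem_stencil1 {l i l' i' u v : ℕ} (hi' : Odd i') (hv : Odd v)
    (hl : l ≤ l') (h : node l i ∈ stencil1 u v) (h' : node l' i' ∈ stencil1 u v) :
    |(i : ℤ) * 2 ^ (l' - l) - i'| < 2 := by
  obtain ⟨k, rfl⟩ := Nat.exists_eq_add_of_le hl
  have hu : l + k ≤ u := le_of_odd_of_node_mem_dyadicGrid hi' (stencil1_subset_dyadicGrid _ _ h')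
  have hdist : |node l i - node (l + k) i'| < 2 / 2 ^ (l + k) :=
    calc |node l i - node (l + k) i'|
        ≤ |node l i - node u v| + |node (l + k) i' - node u v| := by
          rw [abs_sub_comm (node (l + k) i')]
          exact abs_sub_le _ _ _
      _ < 1 / 2 ^ (l + k) + 1 / 2 ^ (l + k) := by
          refine add_lt_add_of_le_of_lt ((abs_sub_node_le_of_mem_stencil1 h).trans ?_)
            (abs_node_sub_node_lt_of_mem_stencil1 hi' hv h')
          gcongr
          exact one_le_two
      _ = 2 / 2 ^ (l + k) := by ring
  rw [← node_add_mul_two_pow l k i, node, node, ← sub_div, abs_div,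
    abs_of_pos (by positivity : (0 : ℝ) < 2 ^ (l + k)),
    div_lt_div_iff_of_pos_right (by positivity)] at hdist
  rw [Nat.add_sub_cancel_left]
  exact_mod_cast hdist

/-! ### One-dimensional Markov kernels -/

/-- The one-dimensional analogue of `IsTMPair`: the kernel `p (s ∧ t) q (s ∨ t)` on `(0,1)` is a
Markov kernel. -/
structure IsMarkovPair (p q : ℝ → ℝ) : Prop where
  p_pos : ∀ x ∈ Set.Ioo (0 : ℝ) 1, 0 < p x
  q_pos : ∀ x ∈ Set.Ioo (0 : ℝ) 1, 0 < q x
  ratio_strictMono : StrictMonoOn (fun x => p x / q x) (Set.Ioo (0 : ℝ) 1)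

/-- The one-dimensional factor of a tensor Markov kernel. -/
def markovKernel (p q : ℝ → ℝ) (s t : ℝ) : ℝ := p (min s t) * q (max s t)

/-- The kernel function at the node `m · 2^{-l}`. It is defined through the nodal values, so that
the end points `0` and `1` are included: their kernel functions vanish on `(0,1)`. -/
def nodeKernel (p q : ℝ → ℝ) (l m : ℕ) (s : ℝ) : ℝ :=
  if node l m ≤ s then pNode p l m * q s else p s * qNode q l m

/-- The `2 × 2` determinant `p_j q_i - p_i q_j` of nodal values at level `l`. -/
def nodeDet (p q : ℝ → ℝ) (l i j : ℕ) : ℝ :=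
  pNode p l j * qNode q l i - pNode p l i * qNode q l j

/-- The coefficient of the kernel function at `y` in the expansion of the one-dimensional basis
function around the node `i · 2^{-l}`. -/
def coef1 (p q : ℝ → ℝ) (l i : ℕ) (y : ℝ) : ℝ :=
  if y = node l i then nodeRatio p q l i
  else if y = node l (i - 1) then -(nodeDet p q l (i - 1) i)⁻¹
  else if y = node l (i + 1) then -(nodeDet p q l i (i + 1))⁻¹
  else 0

section OneDim

variable {p q : ℝ → ℝ} {l i : ℕ}

theorem markovKernel_comm (p q : ℝ → ℝ) (s t : ℝ) :
    markovKernel p q s t = markovKernel p q t s := by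
  rw [markovKernel, min_comm, max_comm, markovKernel]

theorem pNode_of_pos_of_lt (h0 : 0 < i) (h1 : i < 2 ^ l) : pNode p l i = p (node l i) := by
  rw [pNode, if_neg h0.ne', if_neg h1.ne]

theorem qNode_of_pos_of_lt (h0 : 0 < i) (h1 : i < 2 ^ l) : qNode q l i = q (node l i) := by
  rw [qNode, if_neg h0.ne', if_neg h1.ne]

theorem nodeKernel_of_ge {s : ℝ} (h : node l i ≤ s) :
    nodeKernel p q l i s = pNode p l i * q s := if_pos h

theorem nodeKernel_of_le {s : ℝ} (hs : s ∈ Set.Ioo (0 : ℝ) 1) (h : s ≤ node l i) :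
    nodeKernel p q l i s = p s * qNode q l i := by
  obtain rfl | hlt := h.eq_or_lt
  · obtain ⟨h0, h1⟩ := node_mem_Ioo.1 hs
    rw [nodeKernel_of_ge le_rfl, pNode_of_pos_of_lt h0 h1, qNode_of_pos_of_lt h0 h1]
  · exact if_neg hlt.not_ge

theorem nodeKernel_eq_markovKernel (h0 : 0 < i) (h1 : i < 2 ^ l) (s : ℝ) :
    nodeKernel p q l i s = markovKernel p q (node l i) s := by
  rw [nodeKernel, markovKernel, pNode_of_pos_of_lt h0 h1, qNode_of_pos_of_lt h0 h1]
  split_ifs with h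
  · rw [min_eq_left h, max_eq_right h]
  · rw [min_eq_right (not_le.1 h).le, max_eq_left (not_le.1 h).le]

theorem nodeKernel_zero {s : ℝ} (hs : s ∈ Set.Ioo (0 : ℝ) 1) : nodeKernel p q l 0 s = 0 := by
  simp [nodeKernel, node_zero, hs.1.le, pNode]

theorem nodeKernel_two_pow {s : ℝ} (hs : s ∈ Set.Ioo (0 : ℝ) 1) :
    nodeKernel p q l (2 ^ l) s = 0 := by
  simp [nodeKernel, node_two_pow, hs.2.not_ge, qNode]

theorem nodeRatio_eq_div_nodeDet (p q : ℝ → ℝ) (l i : ℕ) : nodeRatio p q l i =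
    nodeDet p q l (i - 1) (i + 1) / (nodeDet p q l (i - 1) i * nodeDet p q l i (i + 1)) := rfl

theorem coef1_node (l i : ℕ) : coef1 p q l i (node l i) = nodeRatio p q l i := if_pos rfl

theorem coef1_node_pred (h0 : 0 < i) :
    coef1 p q l i (node l (i - 1)) = -(nodeDet p q l (i - 1) i)⁻¹ := by
  rw [coef1, if_neg ((node_strictMono l (Nat.sub_lt h0 one_pos)).ne), if_pos rfl]

theorem coef1_node_succ (l i : ℕ) :
    coef1 p q l i (node l (i + 1)) = -(nodeDet p q l i (i + 1))⁻¹ := by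
  rw [coef1, if_neg (node_strictMono l i.lt_succ_self).ne',
    if_neg (node_strictMono l (by omega)).ne', if_pos rfl]

theorem coef1_eq_zero {y : ℝ} (hy : y ∈ Set.Ioo (0 : ℝ) 1) (h : y ∉ stencil1 l i) :
    coef1 p q l i y = 0 := by
  have hne : ∀ m, (m = i - 1 ∨ m = i ∨ m = i + 1) → y ≠ node l m := by
    rintro m hm rfl
    exact h (mem_stencil1.2 ⟨m, ⟨hm, node_mem_Ioo.1 hy⟩, rfl⟩)
  rw [coef1, if_neg (hne _ (by simp)), if_neg (hne _ (by simp)), if_neg (hne _ (by simp))]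

theorem basisFun1_of_mem_Ioc {s : ℝ} (hs : s ∈ Set.Ioc (node l (i - 1)) (node l i)) :
    basisFun1 p q l i s =
      (p s * qNode q l (i - 1) - pNode p l (i - 1) * q s) / nodeDet p q l (i - 1) i := if_pos hs

theorem basisFun1_of_mem_Ioo {s : ℝ} (hs : s ∈ Set.Ioo (node l i) (node l (i + 1))) :
    basisFun1 p q l i s =
      (pNode p l (i + 1) * q s - p s * qNode q l (i + 1)) / nodeDet p q l i (i + 1) :=
  (if_neg fun h => hs.1.not_ge h.2).trans (if_pos hs)

theorem basisFun1_eq_zero {s : ℝ} (hs : s ∉ Set.Ioo (node l (i - 1)) (node l (i + 1))) :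
    basisFun1 p q l i s = 0 :=
  (if_neg fun h => hs ⟨h.1, h.2.trans_lt (node_strictMono l i.lt_succ_self)⟩).trans
    (if_neg fun h => hs ⟨((node_strictMono l).monotone (i.sub_le 1)).trans_lt h.1, h.2⟩)

theorem sum_stencil1 {M : Type*} [AddCommMonoid M] {f : ℝ → M} {g : ℕ → M} (h0 : 0 < i)
    (h1 : i < 2 ^ l) (hfg : ∀ m, 0 < m → m < 2 ^ l → f (node l m) = g m) (hg0 : g 0 = 0)
    (hg1 : g (2 ^ l) = 0) : ∑ t ∈ stencil1 l i, f t = g (i - 1) + g i + g (i + 1) := by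
  have hinterior : ∀ m ∈ ({i - 1, i, i + 1} : Finset ℕ), g m ≠ 0 → 0 < m ∧ m < 2 ^ l := by
    intro m hm hne
    have hm0 : m ≠ 0 := fun h => hne (h ▸ hg0)
    have hm1 : m ≠ 2 ^ l := fun h => hne (h ▸ hg1)
    simp only [Finset.mem_insert, Finset.mem_singleton] at hm
    omega
  rw [stencil1, Finset.sum_image (node_strictMono l).injective.injOn,
    Finset.sum_congr rfl fun m hm =>
      hfg m (Finset.mem_filter.1 hm).2.1 (Finset.mem_filter.1 hm).2.2,
    Finset.sum_filter_of_ne hinterior, Finset.sum_insert, Finset.sum_insert, Finset.sum_singleton,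
    add_assoc]
  · simp
  · simp only [Finset.mem_insert, Finset.mem_singleton]
    omega

namespace IsMarkovPair

variable (hpq : IsMarkovPair p q)

include hpq

theorem nodeDet_pos {j : ℕ} (hij : i < j) (hj : j ≤ 2 ^ l) : 0 < nodeDet p q l i j := by
  have hj0 : j ≠ 0 := by omega
  have hi1 : i ≠ 2 ^ l := by omega
  rcases eq_or_ne i 0 with rfl | hi0 <;> rcases eq_or_ne j (2 ^ l) with rfl | hj1
  · simp [nodeDet, pNode, qNode]
  · simpa [nodeDet, pNode, qNode, hj0, hj1] using
      hpq.p_pos _ (node_mem_Ioo.2 ⟨hij, by omega⟩ : node l j ∈ _)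
  · simpa [nodeDet, pNode, qNode, hi0, hi1] using
      hpq.q_pos _ (node_mem_Ioo.2 ⟨by omega, hij⟩ : node l i ∈ _)
  · have hi : node l i ∈ Set.Ioo (0 : ℝ) 1 := node_mem_Ioo.2 ⟨by omega, by omega⟩
    have hj' : node l j ∈ Set.Ioo (0 : ℝ) 1 := node_mem_Ioo.2 ⟨by omega, by omega⟩
    have hratio : p (node l i) / q (node l i) < p (node l j) / q (node l j) :=
      hpq.ratio_strictMono hi hj' (node_strictMono l hij)
    rw [div_lt_div_iff₀ (hpq.q_pos _ hi) (hpq.q_pos _ hj')] at hratio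
    simpa only [nodeDet, pNode, qNode, hi0, hi1, hj0, hj1, if_false, sub_pos] using hratio

theorem nodeDet_pred_pos (h0 : 0 < i) (h1 : i < 2 ^ l) : 0 < nodeDet p q l (i - 1) i :=
  hpq.nodeDet_pos (Nat.sub_lt h0 one_pos) h1.le

theorem nodeDet_succ_pos (h1 : i < 2 ^ l) : 0 < nodeDet p q l i (i + 1) :=
  hpq.nodeDet_pos i.lt_succ_self h1

theorem nodeRatio_pos (h0 : 0 < i) (h1 : i < 2 ^ l) : 0 < nodeRatio p q l i := by
  rw [nodeRatio_eq_div_nodeDet]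
  exact div_pos (hpq.nodeDet_pos (by omega) h1)
    (mul_pos (hpq.nodeDet_pred_pos h0 h1) (hpq.nodeDet_succ_pos h1))

/-- Three vectors `(p_m, q_m)` of the plane satisfy the linear relation whose coefficients are
their `2 × 2` determinants; `nodeRatio_mul_qNode` is the other component. -/
theorem nodeRatio_mul_pNode (h0 : 0 < i) (h1 : i < 2 ^ l) :
    nodeRatio p q l i * pNode p l i = (nodeDet p q l (i - 1) i)⁻¹ * pNode p l (i - 1) +
      (nodeDet p q l i (i + 1))⁻¹ * pNode p l (i + 1) := by
  have hpred := (hpq.nodeDet_pred_pos h0 h1).ne'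
  have hsucc := (hpq.nodeDet_succ_pos h1).ne'
  rw [nodeRatio_eq_div_nodeDet]
  field_simp
  unfold nodeDet
  ring

theorem nodeRatio_mul_qNode (h0 : 0 < i) (h1 : i < 2 ^ l) :
    nodeRatio p q l i * qNode q l i = (nodeDet p q l (i - 1) i)⁻¹ * qNode q l (i - 1) +
      (nodeDet p q l i (i + 1))⁻¹ * qNode q l (i + 1) := by
  have hpred := (hpq.nodeDet_pred_pos h0 h1).ne'
  have hsucc := (hpq.nodeDet_succ_pos h1).ne'
  rw [nodeRatio_eq_div_nodeDet]
  field_simp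
  unfold nodeDet
  ring

theorem basisFun1_eq_nodeKernel_combination (h0 : 0 < i) (h1 : i < 2 ^ l) {s : ℝ}
    (hs : s ∈ Set.Ioo (0 : ℝ) 1) :
    basisFun1 p q l i s = nodeRatio p q l i * nodeKernel p q l i s -
      (nodeDet p q l (i - 1) i)⁻¹ * nodeKernel p q l (i - 1) s -
      (nodeDet p q l i (i + 1))⁻¹ * nodeKernel p q l (i + 1) s := by
  have hp := hpq.nodeRatio_mul_pNode h0 h1
  have hq := hpq.nodeRatio_mul_qNode h0 h1
  have hpred : node l (i - 1) < node l i := node_strictMono l (Nat.sub_lt h0 one_pos)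
  have hsucc : node l i < node l (i + 1) := node_strictMono l i.lt_succ_self
  rcases le_or_gt s (node l (i - 1)) with ha | ha
  · rw [basisFun1_eq_zero fun h => h.1.not_ge ha, nodeKernel_of_le hs ha,
      nodeKernel_of_le hs (ha.trans hpred.le),
      nodeKernel_of_le hs (ha.trans (hpred.trans hsucc).le)]
    linear_combination -p s * hq
  rcases le_or_gt s (node l i) with hb | hb
  · rw [basisFun1_of_mem_Ioc ⟨ha, hb⟩, nodeKernel_of_ge ha.le, nodeKernel_of_le hs hb,
      nodeKernel_of_le hs (hb.trans hsucc.le), div_eq_inv_mul]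
    linear_combination -p s * hq
  rcases lt_or_ge s (node l (i + 1)) with hc | hc
  · rw [basisFun1_of_mem_Ioo ⟨hb, hc⟩, nodeKernel_of_ge ha.le, nodeKernel_of_ge hb.le,
      nodeKernel_of_le hs hc.le, div_eq_inv_mul]
    linear_combination -q s * hp
  · rw [basisFun1_eq_zero fun h => h.2.not_ge hc, nodeKernel_of_ge ha.le, nodeKernel_of_ge hb.le,
      nodeKernel_of_ge hc]
    linear_combination -q s * hp

theorem sum_coef1_mul_markovKernel (h0 : 0 < i) (h1 : i < 2 ^ l) {s : ℝ}
    (hs : s ∈ Set.Ioo (0 : ℝ) 1) :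
    ∑ t ∈ stencil1 l i, coef1 p q l i t * markovKernel p q t s = basisFun1 p q l i s := by
  rw [sum_stencil1 (g := fun m => coef1 p q l i (node l m) * nodeKernel p q l m s) h0 h1
    (fun m hm0 hm1 => by rw [nodeKernel_eq_markovKernel hm0 hm1])
    (by simp only [nodeKernel_zero hs, mul_zero]) (by simp only [nodeKernel_two_pow hs, mul_zero]),
    coef1_node, coef1_node_pred h0, coef1_node_succ,
    hpq.basisFun1_eq_nodeKernel_combination h0 h1 hs]
  ring

theorem basisFun1_node (h0 : 0 < i) (h1 : i < 2 ^ l) (m : ℕ) :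
    basisFun1 p q l i (node l m) = if m = i then 1 else 0 := by
  have hmono := node_strictMono l
  split_ifs with hm
  · subst hm
    rw [basisFun1_of_mem_Ioc ⟨hmono (Nat.sub_lt h0 one_pos), le_rfl⟩,
      ← pNode_of_pos_of_lt (p := p) h0 h1, ← qNode_of_pos_of_lt (q := q) h0 h1]
    exact div_self (hpq.nodeDet_pred_pos h0 h1).ne'
  · refine basisFun1_eq_zero ?_
    rw [Set.mem_Ioo, hmono.lt_iff_lt, hmono.lt_iff_lt]
    omega

/-- Both sides are the inner product of the two basis functions. -/
theorem sum_coef1_mul_basisFun1_comm {l' i' : ℕ} (h0 : 0 < i) (h1 : i < 2 ^ l) (h0' : 0 < i')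
    (h1' : i' < 2 ^ l') :
    ∑ t ∈ stencil1 l i, coef1 p q l i t * basisFun1 p q l' i' t =
      ∑ t ∈ stencil1 l' i', coef1 p q l' i' t * basisFun1 p q l i t := by
  have hcube : ∀ {m j : ℕ} {t : ℝ}, t ∈ stencil1 m j → t ∈ Set.Ioo (0 : ℝ) 1 := fun ht =>
    mem_Ioo_of_mem_dyadicGrid (stencil1_subset_dyadicGrid _ _ ht)
  calc ∑ t ∈ stencil1 l i, coef1 p q l i t * basisFun1 p q l' i' t
      = ∑ t ∈ stencil1 l i, ∑ s ∈ stencil1 l' i',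
          coef1 p q l i t * (coef1 p q l' i' s * markovKernel p q s t) :=
        Finset.sum_congr rfl fun t ht => by
          rw [← hpq.sum_coef1_mul_markovKernel h0' h1' (hcube ht), Finset.mul_sum]
    _ = ∑ s ∈ stencil1 l' i', ∑ t ∈ stencil1 l i,
          coef1 p q l' i' s * (coef1 p q l i t * markovKernel p q t s) := by
        rw [Finset.sum_comm]
        simp only [markovKernel_comm p q, mul_left_comm]
    _ = ∑ s ∈ stencil1 l' i', coef1 p q l' i' s * basisFun1 p q l i s :=
        Finset.sum_congr rfl fun s hs => by
          rw [← hpq.sum_coef1_mul_markovKernel h0 h1 (hcube hs), Finset.mul_sum]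

theorem basisFun1_eq_ite_of_mem_stencil1 {l' i' : ℕ} (hi : Odd i) (hi' : Odd i')
    (h1' : i' < 2 ^ l') (hl : l ≤ l') {t : ℝ} (ht : t ∈ stencil1 l i) :
    basisFun1 p q l' i' t = if (l = l' ∧ i = i') ∧ t = node l i then 1 else 0 := by
  obtain ⟨k, rfl⟩ := Nat.exists_eq_add_of_le hl
  obtain ⟨m, ⟨hm, -, -⟩, rfl⟩ := mem_stencil1.1 ht
  rw [← node_add_mul_two_pow l k m, hpq.basisFun1_node hi'.pos h1', node_add_mul_two_pow]
  refine if_congr ?_ rfl rfl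
  rw [(node_strictMono l).injective.eq_iff]
  constructor
  · rintro rfl
    obtain rfl : k = 0 := by
      by_contra hk
      exact Nat.not_even_iff_odd.2 (Nat.odd_mul.1 hi').2 (even_two.pow_of_ne_zero hk)
    rw [pow_zero, mul_one] at hi' ⊢
    obtain ⟨r, rfl⟩ := hi
    obtain ⟨r', rfl⟩ := hi'
    omega
  · rintro ⟨⟨hk, rfl⟩, rfl⟩
    obtain rfl : k = 0 := by omega
    rw [pow_zero, mul_one]

theorem sum_coef1_mul_basisFun1 {l' i' : ℕ} (hi : Odd i) (h1 : i < 2 ^ l) (hi' : Odd i')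
    (h1' : i' < 2 ^ l') :
    ∑ t ∈ stencil1 l i, coef1 p q l i t * basisFun1 p q l' i' t =
      if l = l' ∧ i = i' then nodeRatio p q l i else 0 := by
  wlog hl : l ≤ l' generalizing l i l' i'
  · rw [hpq.sum_coef1_mul_basisFun1_comm hi.pos h1 hi'.pos h1', this hi' h1' hi h1 (by omega),
      if_neg (by omega), if_neg (by omega)]
  rw [Finset.sum_congr rfl fun t ht => by
    rw [hpq.basisFun1_eq_ite_of_mem_stencil1 hi hi' h1' hl ht, mul_ite, mul_one, mul_zero]]
  split_ifs with h
  · simp only [h, and_self, true_and]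
    rw [← h.1, ← h.2, Finset.sum_ite_eq', if_pos (node_mem_stencil1 hi.pos h1), coef1_node]
  · simp only [h, false_and, if_false, Finset.sum_const_zero]

end IsMarkovPair

end OneDim

/-! ### Tensor products -/

/-- The stencil of the grid point with level `l` and index `i`: the product of the one-dimensional
stencils. -/
def stencil {d : ℕ} (l i : Fin d → ℕ) : Finset (Fin d → ℝ) :=
  Fintype.piFinset fun j => stencil1 (l j) (i j)

/-- The coefficient of the kernel function at `y` in the expansion of a tensor product basis
function. -/
def coef {d : ℕ} (p q : Fin d → ℝ → ℝ) (l i : Fin d → ℕ) (y : Fin d → ℝ) : ℝ :=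
  ∏ j, coef1 (p j) (q j) (l j) (i j) (y j)

section Tensor

variable {d : ℕ} {p q : Fin d → ℝ → ℝ} {l i l' i' : Fin d → ℕ}

theorem tmKernel_comm (p q : Fin d → ℝ → ℝ) (x y : Fin d → ℝ) :
    tmKernel p q x y = tmKernel p q y x :=
  Finset.prod_congr rfl fun j _ => markovKernel_comm (p j) (q j) (x j) (y j)

theorem mem_stencil {y : Fin d → ℝ} : y ∈ stencil l i ↔ ∀ j, y j ∈ stencil1 (l j) (i j) :=
  Fintype.mem_piFinset

theorem card_stencil_le (l i : Fin d → ℕ) : (stencil l i).card ≤ 3 ^ d := by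
  rw [stencil, Fintype.card_piFinset]
  simpa using Finset.prod_le_pow_card Finset.univ (fun j => (stencil1 (l j) (i j)).card) 3
    fun j _ => card_stencil1_le _ _

theorem mem_Ioo_of_mem_stencil {y : Fin d → ℝ} (h : y ∈ stencil l i) (j : Fin d) :
    y j ∈ Set.Ioo (0 : ℝ) 1 :=
  mem_Ioo_of_mem_dyadicGrid (stencil1_subset_dyadicGrid _ _ (mem_stencil.1 h j))

theorem coef_gridPoint (l i : Fin d → ℕ) :
    coef p q l i (gridPoint l i) = ∏ j, nodeRatio (p j) (q j) (l j) (i j) :=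
  Finset.prod_congr rfl fun _ _ => coef1_node _ _

theorem coef_eq_zero {y : Fin d → ℝ} (hy : ∀ j, y j ∈ Set.Ioo (0 : ℝ) 1) (h : y ∉ stencil l i) :
    coef p q l i y = 0 := by
  obtain ⟨j, hj⟩ := not_forall.1 (mt mem_stencil.2 h)
  exact Finset.prod_eq_zero (Finset.mem_univ j) (coef1_eq_zero (hy j) hj)

namespace IsTMPair

variable (hTM : IsTMPair p q)

include hTM

theorem isMarkovPair (j : Fin d) : IsMarkovPair (p j) (q j) :=
  ⟨hTM.p_pos j, hTM.q_pos j, hTM.ratio_strictMono j⟩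

theorem prod_nodeRatio_pos (h : IsIndex l i) : 0 < ∏ j, nodeRatio (p j) (q j) (l j) (i j) :=
  Finset.prod_pos fun j _ => (hTM.isMarkovPair j).nodeRatio_pos (h j).1.pos (h j).2

theorem sum_coef_mul_tmKernel (h : IsIndex l i) {x : Fin d → ℝ}
    (hx : ∀ j, x j ∈ Set.Ioo (0 : ℝ) 1) :
    ∑ y ∈ stencil l i, coef p q l i y * tmKernel p q y x = basisFun p q l i x :=
  calc ∑ y ∈ stencil l i, coef p q l i y * tmKernel p q y x
      = ∏ j, ∑ t ∈ stencil1 (l j) (i j),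
          coef1 (p j) (q j) (l j) (i j) t * markovKernel (p j) (q j) t (x j) := by
        simp only [Finset.prod_univ_sum, Finset.prod_mul_distrib]
        rfl
    _ = basisFun p q l i x := Finset.prod_congr rfl fun j _ =>
        (hTM.isMarkovPair j).sum_coef1_mul_markovKernel (h j).1.pos (h j).2 (hx j)

theorem sum_coef_mul_basisFun (h : IsIndex l i) (h' : IsIndex l' i') :
    ∑ y ∈ stencil l i, coef p q l i y * basisFun p q l' i' y =
      if l = l' ∧ i = i' then ∏ j, nodeRatio (p j) (q j) (l j) (i j) else 0 :=
  calc ∑ y ∈ stencil l i, coef p q l i y * basisFun p q l' i' y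
      = ∏ j, ∑ t ∈ stencil1 (l j) (i j),
          coef1 (p j) (q j) (l j) (i j) t * basisFun1 (p j) (q j) (l' j) (i' j) t := by
        simp only [Finset.prod_univ_sum, Finset.prod_mul_distrib]
        rfl
    _ = ∏ j, if l j = l' j ∧ i j = i' j then nodeRatio (p j) (q j) (l j) (i j) else 0 :=
        Finset.prod_congr rfl fun j _ =>
          (hTM.isMarkovPair j).sum_coef1_mul_basisFun1 (h j).1 (h j).2 (h' j).1 (h' j).2
    _ = _ := by
        rw [Finset.prod_ite_zero]
        simp only [Finset.mem_univ, true_implies, forall_and, funext_iff]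

end IsTMPair

end Tensor

/-! ### Reproducing kernel Hilbert spaces -/

section KernelCombinations

variable {X H : Type*} [NormedAddCommGroup H] [InnerProductSpace ℝ H] [CompleteSpace H]
  [RKHS ℝ H X ℝ] {ι : Type*} [Fintype ι]

theorem sum_smul_kerFun_apply (c : ι → ℝ) (y : ι → X) (x : X) :
    (∑ a, c a • RKHS.kerFun H (y a) (1 : ℝ)) x = ∑ a, c a * RKHS.kernel H x (y a) (1 : ℝ) := by
  rw [← RKHS.adjoint_kerFun, map_sum]
  simp only [RKHS.adjoint_kerFun, RKHS.coe_smul, Pi.smul_apply, smul_eq_mul, RKHS.kerFun_apply]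

theorem norm_sum_smul_kerFun_sq (c : ι → ℝ) (y : ι → X) :
    ‖∑ a, c a • RKHS.kerFun H (y a) (1 : ℝ)‖ ^ 2 =
      ∑ b, c b * (∑ a, c a • RKHS.kerFun H (y a) (1 : ℝ)) (y b) := by
  rw [← real_inner_self_eq_norm_sq, inner_sum]
  refine Finset.sum_congr rfl fun b _ => ?_
  rw [inner_smul_right, RKHS.inner_kerFun]
  simp

end KernelCombinations

theorem IsTMPair.exists_basisFun_mem {d : ℕ} {p q : Fin d → ℝ → ℝ} (hTM : IsTMPair p q)
    {l i : Fin d → ℕ} (h : IsIndex l i) {H : Type*} [NormedAddCommGroup H]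
    [InnerProductSpace ℝ H] [CompleteSpace H] [RKHS ℝ H (UnitCube d) ℝ]
    (hH : HasTMKernel p q H) :
    ∃ φ : H, (∀ x : UnitCube d, φ x = basisFun p q l i x.1) ∧
      ∏ j, nodeRatio (p j) (q j) (l j) (i j) = ‖φ‖ ^ 2 := by
  let pt (y : stencil l i) : UnitCube d := ⟨y, mem_Ioo_of_mem_stencil y.2⟩
  let φ : H := ∑ y : stencil l i, coef p q l i y • RKHS.kerFun H (pt y) (1 : ℝ)
  have hφ (x : UnitCube d) : φ x = basisFun p q l i x := by
    rw [sum_smul_kerFun_apply, ← hTM.sum_coef_mul_tmKernel h x.2,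
      ← Finset.sum_coe_sort (stencil l i)]
    exact Finset.sum_congr rfl fun y _ => by rw [hH, tmKernel_comm]
  refine ⟨φ, hφ, ?_⟩
  calc ∏ j, nodeRatio (p j) (q j) (l j) (i j)
      = ∑ y ∈ stencil l i, coef p q l i y * basisFun p q l i y := by
        rw [hTM.sum_coef_mul_basisFun h h, if_pos ⟨rfl, rfl⟩]
    _ = ∑ y : stencil l i, coef p q l i y * φ (pt y) := by
        simp only [hφ, pt,
          Finset.sum_coe_sort (stencil l i) fun y => coef p q l i y * basisFun p q l i y]
    _ = ‖φ‖ ^ 2 := (norm_sum_smul_kerFun_sq _ _).symm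

/-! ### Points of sparse grids -/

section SparseGrid

variable {d τ : ℕ} {l i : Fin d → ℕ}

theorem gridPoint_inj {l' i' : Fin d → ℕ} (h : IsIndex l i) (h' : IsIndex l' i') :
    gridPoint l i = gridPoint l' i' ↔ l = l' ∧ i = i' := by
  simp only [funext_iff, gridPoint, ← forall_and]
  exact forall_congr' fun j => node_eq_node_iff_of_odd (h j).1 (h' j).1

theorem mem_sparseGrid {x : Fin d → ℝ} :
    x ∈ sparseGrid d τ ↔ ∃ l : Fin d → ℕ, ∑ j, l j ≤ τ + d - 1 ∧ ∀ j, x j ∈ dyadicGrid (l j) := by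
  simp only [sparseGrid, Finset.mem_biUnion, Finset.mem_filter, Fintype.mem_piFinset,
    Finset.mem_Icc]
  refine exists_congr fun l => ⟨fun h => ⟨h.1.2, h.2⟩, fun h => ⟨⟨fun j => ⟨?_, ?_⟩, h.1⟩, h.2⟩⟩
  · obtain ⟨k, hk, -⟩ := mem_dyadicGrid.1 (h.2 j)
    by_contra hlj
    rw [Nat.lt_one_iff.1 (not_le.1 hlj)] at hk
    omega
  · exact (Finset.single_le_sum (fun _ _ => Nat.zero_le _) (Finset.mem_univ j)).trans h.1

theorem sparseGrid_subset_succ (d τ : ℕ) : sparseGrid d τ ⊆ sparseGrid d (τ + 1) := by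
  intro x hx
  obtain ⟨l, hl, hx⟩ := mem_sparseGrid.1 hx
  exact mem_sparseGrid.2 ⟨l, by omega, hx⟩

theorem sum_level_le_of_gridPoint_mem (h : IsIndex l i) (hx : gridPoint l i ∈ sparseGrid d τ) :
    ∑ j, l j ≤ τ + d - 1 := by
  obtain ⟨m, hm, hx⟩ := mem_sparseGrid.1 hx
  exact (Finset.sum_le_sum fun j _ => le_of_odd_of_node_mem_dyadicGrid (h j).1 (hx j)).trans hm

theorem exists_gridPoint_eq_of_mem_sparseGrid {x : Fin d → ℝ} (hx : x ∈ sparseGrid d τ) :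
    ∃ l i : Fin d → ℕ, IsIndex l i ∧ gridPoint l i = x := by
  obtain ⟨m, -, hx⟩ := mem_sparseGrid.1 hx
  choose l i hi hli using fun j => exists_odd_of_mem_dyadicGrid (hx j)
  exact ⟨l, i, hi, funext hli⟩

theorem stencil_subset_sparseGrid (h : IsIndex l i) (hx : gridPoint l i ∈ sparseGrid d τ) :
    stencil l i ⊆ sparseGrid d τ := fun _ hy =>
  mem_sparseGrid.2 ⟨l, sum_level_le_of_gridPoint_mem h hx, fun j =>
    stencil1_subset_dyadicGrid _ _ (mem_stencil.1 hy j)⟩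

theorem mem_sparseGrid_of_mem_stencil (h : IsIndex l i)
    (hx : gridPoint l i ∈ sparseGrid d (τ + 1)) {y : Fin d → ℝ} (hy : y ∈ stencil l i)
    (hne : y ≠ gridPoint l i) : y ∈ sparseGrid d τ := by
  have hcoarse (j : Fin d) :
      ∃ m ≤ l j, y j ∈ dyadicGrid m ∧ (y j ≠ node (l j) (i j) → m < l j) := by
    have hyj := mem_stencil.1 hy j
    rcases eq_node_or_mem_dyadicGrid_of_mem_stencil1 (h j).1 hyj with he | ⟨m, hm, hmem⟩
    · exact ⟨l j, le_rfl, stencil1_subset_dyadicGrid _ _ hyj, fun hne => absurd he hne⟩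
    · exact ⟨m, hm.le, hmem, fun _ => hm⟩
  choose m hm hmem hlt using hcoarse
  obtain ⟨j, hj⟩ := Function.ne_iff.1 hne
  have hsum : ∑ j, m j < ∑ j, l j :=
    Finset.sum_lt_sum (fun j _ => hm j) ⟨j, Finset.mem_univ j, hlt j hj⟩
  have hl := sum_level_le_of_gridPoint_mem h hx
  exact mem_sparseGrid.2 ⟨m, by omega, hmem⟩

theorem card_dyadicGrid (m : ℕ) : (dyadicGrid m).card = 2 ^ m - 1 := by
  rw [dyadicGrid, Finset.card_image_of_injective _ (node_strictMono m).injective, Nat.card_Icc,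
    Nat.add_sub_cancel]

theorem two_pow_sub_one_le_card_sparseGrid (hd : 1 ≤ d) (τ : ℕ) :
    2 ^ τ - 1 ≤ (sparseGrid d τ).card := by
  let j₀ : Fin d := ⟨0, hd⟩
  rw [← card_dyadicGrid]
  refine Finset.card_le_card_of_injOn (Function.update (fun _ => node 1 1) j₀) (fun t ht => ?_)
    (Function.update_injective _ j₀).injOn
  refine mem_sparseGrid.2 ⟨Function.update (fun _ => 1) j₀ τ, ?_, fun j => ?_⟩
  · rw [Finset.sum_update_of_mem (Finset.mem_univ j₀)]
    simp only [Finset.sum_const, smul_eq_mul, mul_one, Finset.card_sdiff, Finset.card_univ,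
      Fintype.card_fin, Finset.inter_univ, Finset.card_singleton]
    omega
  · rcases eq_or_ne j j₀ with rfl | hj
    · simpa only [Function.update_self] using Finset.mem_coe.1 ht
    · simp only [Function.update_of_ne hj]
      exact mem_dyadicGrid.2 ⟨1, by norm_num, rfl⟩

end SparseGrid

/-! ### Kernel matrices of hierarchical sets -/

/-- The level and the index of a grid point, with an arbitrary value elsewhere. -/
def levelIndex {d : ℕ} : (Fin d → ℝ) → (Fin d → ℕ) × (Fin d → ℕ) :=
  Function.invFunOn (fun li => gridPoint li.1 li.2) {li | IsIndex li.1 li.2}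

/-- The stencil of a grid point. -/
def stencilAt {d : ℕ} (x : Fin d → ℝ) : Finset (Fin d → ℝ) :=
  stencil (levelIndex x).1 (levelIndex x).2

/-- The basis function `φ_x` at a grid point `x`. -/
def basisFunAt {d : ℕ} (p q : Fin d → ℝ → ℝ) (x : Fin d → ℝ) : (Fin d → ℝ) → ℝ :=
  basisFun p q (levelIndex x).1 (levelIndex x).2

/-- The coefficient of the kernel function at `y` in the expansion of `φ_x`. The squared norm of
`φ_x` is `coefAt p q x x`. -/
def coefAt {d : ℕ} (p q : Fin d → ℝ → ℝ) (x y : Fin d → ℝ) : ℝ :=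
  coef p q (levelIndex x).1 (levelIndex x).2 y

/-- A hierarchical set: a finite set of grid points that contains the stencils of its points. -/
def IsHierarchical {d : ℕ} (X : Finset (Fin d → ℝ)) : Prop :=
  ∀ x ∈ X, (∃ l i, IsIndex l i ∧ gridPoint l i = x) ∧ stencilAt x ⊆ X

/-- The matrix that expands the basis functions at the points of `X` in kernel functions. -/
def hierMatrix {d : ℕ} (p q : Fin d → ℝ → ℝ) (X : Finset (Fin d → ℝ)) : Matrix X X ℝ :=
  Matrix.of fun x y => coefAt p q x y

section Hierarchical

variable {d : ℕ} {p q : Fin d → ℝ → ℝ} {l i : Fin d → ℕ}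

theorem levelIndex_gridPoint (h : IsIndex l i) : levelIndex (gridPoint l i) = (l, i) := by
  have hinj : Set.InjOn (fun li : (Fin d → ℕ) × (Fin d → ℕ) => gridPoint li.1 li.2)
      {li | IsIndex li.1 li.2} := fun a ha b hb hab => Prod.ext_iff.2 ((gridPoint_inj ha hb).1 hab)
  exact hinj.leftInvOn_invFunOn (show (l, i) ∈ {li | IsIndex li.1 li.2} from h)

theorem stencilAt_gridPoint (h : IsIndex l i) : stencilAt (gridPoint l i) = stencil l i := by
  rw [stencilAt, levelIndex_gridPoint h]

theorem coefAt_gridPoint (h : IsIndex l i) : coefAt p q (gridPoint l i) = coef p q l i := by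
  funext y
  rw [coefAt, levelIndex_gridPoint h]

theorem basisFunAt_gridPoint (h : IsIndex l i) :
    basisFunAt p q (gridPoint l i) = basisFun p q l i := by
  rw [basisFunAt, levelIndex_gridPoint h]

theorem coefAt_gridPoint_self (h : IsIndex l i) :
    coefAt p q (gridPoint l i) (gridPoint l i) = ∏ j, nodeRatio (p j) (q j) (l j) (i j) := by
  rw [coefAt_gridPoint h, coef_gridPoint]

theorem card_stencilAt_le (x : Fin d → ℝ) : (stencilAt x).card ≤ 3 ^ d := card_stencil_le _ _

theorem kernelMatrix_transpose (p q : Fin d → ℝ → ℝ) (S T : Finset (Fin d → ℝ)) :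
    (kernelMatrix p q S T).transpose = kernelMatrix p q T S := by
  ext x y
  exact tmKernel_comm p q y x

theorem inv_kernelMatrix_comm {X : Finset (Fin d → ℝ)} (x y : X) :
    (kernelMatrix p q X X)⁻¹ x y = (kernelMatrix p q X X)⁻¹ y x := by
  conv_lhs => rw [← kernelMatrix_transpose, ← Matrix.transpose_nonsing_inv, Matrix.transpose_apply]

theorem abs_sub_lt_two_of_mem_stencil {l' i' l'' i'' : Fin d → ℕ} (h : IsIndex l i)
    (h' : IsIndex l' i') (h'' : IsIndex l'' i'') (hmem' : gridPoint l' i' ∈ stencil l i)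
    (hmem'' : gridPoint l'' i'' ∈ stencil l i) (j : Fin d) :
    |(i' j : ℤ) * 2 ^ (max (l' j) (l'' j) - l' j) -
      (i'' j : ℤ) * 2 ^ (max (l' j) (l'' j) - l'' j)| < 2 := by
  wlog hl : l' j ≤ l'' j generalizing l' i' l'' i''
  · rw [abs_sub_comm, max_comm]
    exact this h'' h' hmem'' hmem' (not_le.1 hl).le
  rw [max_eq_right hl, Nat.sub_self, pow_zero, mul_one]
  exact abs_sub_lt_two_of_mem_stencil1 (h'' j).1 (h j).1 hl (mem_stencil.1 hmem' j)
    (mem_stencil.1 hmem'' j)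

namespace IsHierarchical

variable {X : Finset (Fin d → ℝ)} (hX : IsHierarchical X)

include hX

theorem mem_Ioo {x : Fin d → ℝ} (hx : x ∈ X) (j : Fin d) : x j ∈ Set.Ioo (0 : ℝ) 1 := by
  obtain ⟨⟨l, i, h, rfl⟩, -⟩ := hX x hx
  exact node_mem_Ioo.2 ⟨(h j).1.pos, (h j).2⟩

theorem coefAt_self_pos (hTM : IsTMPair p q) {x : Fin d → ℝ} (hx : x ∈ X) :
    0 < coefAt p q x x := by
  obtain ⟨⟨l, i, h, rfl⟩, -⟩ := hX x hx
  rw [coefAt_gridPoint_self h]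
  exact hTM.prod_nodeRatio_pos h

theorem mem_stencilAt_of_coefAt_ne_zero {x y : Fin d → ℝ} (hy : y ∈ X)
    (h : coefAt p q x y ≠ 0) : y ∈ stencilAt x :=
  not_imp_comm.1 (coef_eq_zero (hX.mem_Ioo hy)) h

theorem sum_coefAt_mul {x : Fin d → ℝ} (hx : x ∈ X) (f : (Fin d → ℝ) → ℝ) :
    ∑ y : X, coefAt p q x y * f y = ∑ y ∈ stencilAt x, coefAt p q x y * f y := by
  rw [Finset.sum_coe_sort X fun y => coefAt p q x y * f y]
  refine (Finset.sum_subset (hX x hx).2 fun y hy hn => ?_).symm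
  rw [not_imp_comm.1 (hX.mem_stencilAt_of_coefAt_ne_zero hy) hn, zero_mul]

theorem kernelMatrix_mul_transpose_hierMatrix (hTM : IsTMPair p q) :
    kernelMatrix p q X X * (hierMatrix p q X).transpose =
      Matrix.of fun y x : X => basisFunAt p q x y := by
  ext y ⟨x, hx⟩
  calc ∑ z : X, tmKernel p q y z * coefAt p q x z
      = ∑ z : X, coefAt p q x z * tmKernel p q z y :=
        Finset.sum_congr rfl fun z _ => by rw [mul_comm, tmKernel_comm]
    _ = ∑ z ∈ stencilAt x, coefAt p q x z * tmKernel p q z y :=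
        hX.sum_coefAt_mul hx fun z => tmKernel p q z y
    _ = basisFunAt p q x y := by
        obtain ⟨⟨l, i, h, rfl⟩, -⟩ := hX x hx
        rw [stencilAt_gridPoint h, coefAt_gridPoint h, basisFunAt_gridPoint h]
        exact hTM.sum_coef_mul_tmKernel h (hX.mem_Ioo y.2)

theorem hierMatrix_mul_kernelMatrix_mul (hTM : IsTMPair p q) :
    hierMatrix p q X * (kernelMatrix p q X X * (hierMatrix p q X).transpose) =
      Matrix.diagonal fun x : X => coefAt p q x x := by
  rw [hX.kernelMatrix_mul_transpose_hierMatrix hTM]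
  ext ⟨x, hx⟩ ⟨x', hx'⟩
  rw [Matrix.diagonal_apply]
  refine (hX.sum_coefAt_mul hx (basisFunAt p q x')).trans ?_
  obtain ⟨⟨l, i, h, rfl⟩, -⟩ := hX x hx
  obtain ⟨⟨l', i', h', rfl⟩, -⟩ := hX x' hx'
  simp only [stencilAt_gridPoint h, coefAt_gridPoint h, basisFunAt_gridPoint h', Subtype.mk.injEq,
    gridPoint_inj h h', coef_gridPoint]
  exact hTM.sum_coef_mul_basisFun h h'

theorem kernelMatrix_mul_eq_one (hTM : IsTMPair p q) :
    kernelMatrix p q X X * ((hierMatrix p q X).transpose *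
      (Matrix.diagonal (fun x : X => (coefAt p q x x)⁻¹) * hierMatrix p q X)) = 1 := by
  have hdiag : (Matrix.diagonal fun x : X => coefAt p q x x) *
      Matrix.diagonal (fun x : X => (coefAt p q x x)⁻¹) = 1 := by
    rw [Matrix.diagonal_mul_diagonal, ← Matrix.diagonal_one]
    exact congrArg _ (funext fun x => mul_inv_cancel₀ (hX.coefAt_self_pos hTM x.2).ne')
  rw [← hX.hierMatrix_mul_kernelMatrix_mul hTM, Matrix.mul_assoc, mul_eq_one_comm] at hdiag
  simpa only [Matrix.mul_assoc] using hdiag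

theorem isUnit_det_kernelMatrix (hTM : IsTMPair p q) : IsUnit (kernelMatrix p q X X).det :=
  Matrix.isUnit_det_of_right_inverse (hX.kernelMatrix_mul_eq_one hTM)

theorem inv_kernelMatrix_apply (hTM : IsTMPair p q) (y z : X) :
    (kernelMatrix p q X X)⁻¹ y z =
      ∑ x : X, coefAt p q x y * ((coefAt p q x x)⁻¹ * coefAt p q x z) := by
  rw [Matrix.inv_eq_right_inv (hX.kernelMatrix_mul_eq_one hTM), Matrix.mul_apply]
  simp only [Matrix.diagonal_mul]
  rfl

theorem exists_mem_stencilAt_of_inv_ne_zero (hTM : IsTMPair p q) {y z : X}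
    (h : (kernelMatrix p q X X)⁻¹ y z ≠ 0) :
    ∃ x ∈ X, y.1 ∈ stencilAt x ∧ z.1 ∈ stencilAt x := by
  rw [hX.inv_kernelMatrix_apply hTM] at h
  obtain ⟨x, -, hx⟩ := Finset.exists_ne_zero_of_sum_ne_zero h
  exact ⟨x, x.2, hX.mem_stencilAt_of_coefAt_ne_zero y.2 (left_ne_zero_of_mul hx),
    hX.mem_stencilAt_of_coefAt_ne_zero z.2 (right_ne_zero_of_mul (right_ne_zero_of_mul hx))⟩

theorem inv_kernelMatrix_apply_of_forall_eq (hTM : IsTMPair p q) (y z : X)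
    (hz : ∀ x ∈ X, z.1 ∈ stencilAt x → x = z) :
    (kernelMatrix p q X X)⁻¹ y z = coefAt p q z y := by
  rw [hX.inv_kernelMatrix_apply hTM, Finset.sum_eq_single z]
  · rw [inv_mul_cancel₀ (hX.coefAt_self_pos hTM z.2).ne', mul_one]
  · intro x _ hne
    have hcoef : coefAt p q x z = 0 := by
      by_contra h
      exact hne (Subtype.ext (hz x x.2 (hX.mem_stencilAt_of_coefAt_ne_zero z.2 h)))
    rw [hcoef, mul_zero, mul_zero]
  · exact fun h => absurd (Finset.mem_univ z) h

theorem inv_kernelMatrix_eq_zero_of_two_le_abs_sub (hTM : IsTMPair p q)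
    {l' i' l'' i'' : Fin d → ℕ} (hi' : IsIndex l' i') (hi'' : IsIndex l'' i'')
    (h' : gridPoint l' i' ∈ X) (h'' : gridPoint l'' i'' ∈ X)
    (hsep : ∃ j, 2 ≤ |(i' j : ℤ) * 2 ^ (max (l' j) (l'' j) - l' j) -
      (i'' j : ℤ) * 2 ^ (max (l' j) (l'' j) - l'' j)|) :
    (kernelMatrix p q X X)⁻¹ ⟨gridPoint l' i', h'⟩ ⟨gridPoint l'' i'', h''⟩ = 0 := by
  by_contra hne
  obtain ⟨x, hx, hx', hx''⟩ := hX.exists_mem_stencilAt_of_inv_ne_zero hTM hne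
  obtain ⟨⟨l, i, h, rfl⟩, -⟩ := hX x hx
  rw [stencilAt_gridPoint h] at hx' hx''
  obtain ⟨j, hj⟩ := hsep
  exact hj.not_gt (abs_sub_lt_two_of_mem_stencil h hi' hi'' hx' hx'' j)

end IsHierarchical

end Hierarchical

/-! ### Bounds on the number of nonzero entries -/

theorem nnz_submatrix_le {m n m' n' : Type*} [Fintype m] [Fintype n] [Fintype m'] [Fintype n']
    (M : Matrix m n ℝ) {f : m' → m} {g : n' → n} (hf : Function.Injective f)
    (hg : Function.Injective g) : nnz (M.submatrix f g) ≤ nnz M :=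
  Finset.card_le_card_of_injOn (Prod.map f g)
    (fun _ h => Finset.mem_coe.2 <|
      Finset.mem_filter.2 ⟨Finset.mem_univ _, (Finset.mem_filter.1 h).2⟩)
    (hf.prodMap hg).injOn

theorem nnz_le_of_forall_exists_mem {α β γ : Type*} {S : Finset α} {T : Finset β}
    {X : Finset γ} {P : γ → Finset α} {Q : γ → Finset β} {a b : ℕ} (M : Matrix S T ℝ)
    (hM : ∀ y z, M y z ≠ 0 → ∃ x ∈ X, y.1 ∈ P x ∧ z.1 ∈ Q x) (hP : ∀ x, (P x).card ≤ a)
    (hQ : ∀ x, (Q x).card ≤ b) : nnz M ≤ X.card * (a * b) := by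
  classical
  calc nnz M ≤ (X.biUnion fun x => P x ×ˢ Q x).card := by
        refine Finset.card_le_card_of_injOn (Prod.map Subtype.val Subtype.val) (fun yz h => ?_)
          (Subtype.val_injective.prodMap Subtype.val_injective).injOn
        obtain ⟨x, hx, hy, hz⟩ := hM _ _ (Finset.mem_filter.1 h).2
        exact Finset.mem_coe.2 (Finset.mem_biUnion.2 ⟨x, hx, Finset.mem_product.2 ⟨hy, hz⟩⟩)
    _ ≤ X.card * (a * b) := Finset.card_biUnion_le_card_mul _ _ _ fun x _ => by
        rw [Finset.card_product]
        exact Nat.mul_le_mul (hP x) (hQ x)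

theorem IsHierarchical.nnz_inv_kernelMatrix_le {d : ℕ} {p q : Fin d → ℝ → ℝ}
    {X : Finset (Fin d → ℝ)} (hX : IsHierarchical X) (hTM : IsTMPair p q) :
    nnz (kernelMatrix p q X X)⁻¹ ≤ X.card * 9 ^ d := by
  rw [show 9 = 3 * 3 from rfl, mul_pow]
  exact nnz_le_of_forall_exists_mem _ (fun _ _ => hX.exists_mem_stencilAt_of_inv_ne_zero hTM)
    card_stencilAt_le card_stencilAt_le

/-! ### Block inverses -/

theorem inv_fromBlocks_eq {m n R : Type*} [Fintype m] [Fintype n] [DecidableEq m] [DecidableEq n]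
    [CommRing R] {a : Matrix m m R} {b : Matrix m n R} {c : Matrix n m R} {e : Matrix n n R}
    (ha : IsUnit a.det) (h : IsUnit (Matrix.fromBlocks a b c e).det) :
    (Matrix.fromBlocks a b c e)⁻¹ =
      let s := (Matrix.fromBlocks a b c e)⁻¹.toBlocks₂₂
      Matrix.fromBlocks (a⁻¹ + a⁻¹ * b * s * (c * a⁻¹)) (-(a⁻¹ * b * s)) (-(s * (c * a⁻¹))) s := by
  let _ := a.invertibleOfIsUnitDet ha
  let _ := (Matrix.fromBlocks a b c e).invertibleOfIsUnitDet h
  let _ := Matrix.invertibleOfFromBlocks₁₁Invertible a b c e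
  rw [← Matrix.invOf_eq_nonsing_inv, Matrix.invOf_fromBlocks₁₁_eq, Matrix.toBlocks_fromBlocks₂₂]
  simp only [Matrix.invOf_eq_nonsing_inv, Matrix.mul_assoc]

/-- The matrix `k(S, S)⁻¹ k(S, A)` of kriging weights, called `B` in the theorem. -/
def krigingMatrix {d : ℕ} (p q : Fin d → ℝ → ℝ) (S A : Finset (Fin d → ℝ)) : Matrix S A ℝ :=
  (kernelMatrix p q S S)⁻¹ * kernelMatrix p q S A

theorem submatrix_inv_kernelMatrix_union {d : ℕ} {p q : Fin d → ℝ → ℝ}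
    {S A : Finset (Fin d → ℝ)} (hSA : Disjoint S A) (hS : IsUnit (kernelMatrix p q S S).det)
    (hX : IsUnit (kernelMatrix p q (S ∪ A) (S ∪ A)).det) :
    let e := Equiv.Finset.union S A hSA
    let B := krigingMatrix p q S A
    let D := ((kernelMatrix p q (S ∪ A) (S ∪ A))⁻¹.submatrix e e).toBlocks₂₂
    (kernelMatrix p q (S ∪ A) (S ∪ A))⁻¹.submatrix e e =
      Matrix.fromBlocks ((kernelMatrix p q S S)⁻¹ + B * D * B.transpose) (-(B * D))
        (-(D * B.transpose)) D := by
  intro e B _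
  have hblocks : (kernelMatrix p q (S ∪ A) (S ∪ A)).submatrix e e =
      Matrix.fromBlocks (kernelMatrix p q S S) (kernelMatrix p q S A) (kernelMatrix p q A S)
        (kernelMatrix p q A A) := by
    ext (x | x) (y | y) <;> rfl
  have hB : kernelMatrix p q A S * (kernelMatrix p q S S)⁻¹ = B.transpose := by
    rw [show B.transpose = _ from Matrix.transpose_mul _ _, Matrix.transpose_nonsing_inv,
      kernelMatrix_transpose, kernelMatrix_transpose]
  rw [← Matrix.det_submatrix_equiv_self e, hblocks] at hX
  have hinv := inv_fromBlocks_eq hS hX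
  rwa [← hblocks, Matrix.inv_submatrix_equiv, hB] at hinv

/-! ### Truncated sparse grids -/

theorem isHierarchical_sparseGrid (d τ : ℕ) : IsHierarchical (sparseGrid d τ) := by
  intro x hx
  obtain ⟨l, i, h, rfl⟩ := exists_gridPoint_eq_of_mem_sparseGrid hx
  exact ⟨⟨l, i, h, rfl⟩, stencilAt_gridPoint h ▸ stencil_subset_sparseGrid h hx⟩

theorem mem_sparseGrid_of_mem_stencilAt {d τ : ℕ} {x y : Fin d → ℝ}
    (hx : x ∈ sparseGrid d (τ + 1)) (hy : y ∈ stencilAt x) (hne : y ≠ x) : y ∈ sparseGrid d τ := by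
  obtain ⟨l, i, h, rfl⟩ := exists_gridPoint_eq_of_mem_sparseGrid hx
  exact mem_sparseGrid_of_mem_stencil h hx (stencilAt_gridPoint h ▸ hy) hne

theorem one_le_log_of_three_le {x : ℝ} (hx : 3 ≤ x) : 1 ≤ Real.log x :=
  (Real.le_log_iff_exp_le (by linarith)).2 (Real.exp_one_lt_three.le.trans hx)

namespace IsTSG

variable {d n τ : ℕ} {A : Finset (Fin d → ℝ)} (hA : IsTSG n τ A) {p q : Fin d → ℝ → ℝ}

include hA

theorem card_union : (sparseGrid d τ ∪ A).card = n := by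
  rw [Finset.card_union_of_disjoint hA.disjoint, hA.card_add]

theorem union_subset_sparseGrid_succ : sparseGrid d τ ∪ A ⊆ sparseGrid d (τ + 1) :=
  Finset.union_subset (sparseGrid_subset_succ d τ) (hA.subset.trans Finset.sdiff_subset)

theorem isHierarchical : IsHierarchical (sparseGrid d τ ∪ A) := by
  intro x hx
  have hx' := hA.union_subset_sparseGrid_succ hx
  refine ⟨exists_gridPoint_eq_of_mem_sparseGrid hx', fun y hy => ?_⟩
  rcases eq_or_ne y x with rfl | hne
  · exact hx
  · exact Finset.mem_union_left _ (mem_sparseGrid_of_mem_stencilAt hx' hy hne)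

theorem eq_of_mem_stencilAt {x z : Fin d → ℝ} (hx : x ∈ sparseGrid d τ ∪ A) (hz : z ∈ A)
    (h : z ∈ stencilAt x) : x = z := by
  by_contra hne
  exact Finset.disjoint_left.1 hA.disjoint
    (mem_sparseGrid_of_mem_stencilAt (hA.union_subset_sparseGrid_succ hx) h (Ne.symm hne)) hz

theorem inv_kernelMatrix_apply (hTM : IsTMPair p q) (y z : ↥(sparseGrid d τ ∪ A))
    (hz : z.1 ∈ A) :
    (kernelMatrix p q (sparseGrid d τ ∪ A) (sparseGrid d τ ∪ A))⁻¹ y z = coefAt p q z y :=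
  hA.isHierarchical.inv_kernelMatrix_apply_of_forall_eq hTM y z
    fun _ hx h => hA.eq_of_mem_stencilAt hx hz h

theorem mem_stencilAt_of_inv_ne_zero (hTM : IsTMPair p q) {y z : ↥(sparseGrid d τ ∪ A)}
    (hz : z.1 ∈ A)
    (h : (kernelMatrix p q (sparseGrid d τ ∪ A) (sparseGrid d τ ∪ A))⁻¹ y z ≠ 0) :
    y.1 ∈ stencilAt z.1 := by
  rw [hA.inv_kernelMatrix_apply hTM y z hz] at h
  exact hA.isHierarchical.mem_stencilAt_of_coefAt_ne_zero y.2 h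

theorem inv_kernelMatrix_eq_zero_of_ne (hTM : IsTMPair p q) {y z : ↥(sparseGrid d τ ∪ A)}
    (hy : y.1 ∈ A) (hz : z.1 ∈ A) (hne : y ≠ z) :
    (kernelMatrix p q (sparseGrid d τ ∪ A) (sparseGrid d τ ∪ A))⁻¹ y z = 0 := by
  by_contra h
  exact hne (Subtype.ext
    (hA.eq_of_mem_stencilAt z.2 hy (hA.mem_stencilAt_of_inv_ne_zero hTM hz h)).symm)

theorem inv_kernelMatrix_eq_zero_of_notMem_hyperrect (hTM : IsTMPair p q)
    {l' i' l'' i'' : Fin d → ℕ} (hi' : IsIndex l' i') (hi'' : IsIndex l'' i'')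
    (h' : gridPoint l' i' ∈ sparseGrid d τ ∪ A) (h'' : gridPoint l'' i'' ∈ sparseGrid d τ ∪ A)
    (hmem : gridPoint l'' i'' ∈ A) (hrect : gridPoint l'' i'' ∉ hyperrect l' i') :
    (kernelMatrix p q (sparseGrid d τ ∪ A) (sparseGrid d τ ∪ A))⁻¹
      ⟨gridPoint l' i', h'⟩ ⟨gridPoint l'' i'', h''⟩ = 0 := by
  by_contra hne
  have hst := hA.mem_stencilAt_of_inv_ne_zero hTM hmem hne
  rw [stencilAt_gridPoint hi''] at hst
  exact hrect fun j => node_mem_Ioo_of_mem_stencil1 (hi' j).1 (hi'' j).1 (mem_stencil.1 hst j)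

theorem submatrix_inv_kernelMatrix (hTM : IsTMPair p q) :
    let e := Equiv.Finset.union (sparseGrid d τ) A hA.disjoint
    let B := krigingMatrix p q (sparseGrid d τ) A
    let D := Matrix.diagonal fun x : A => coefAt p q x x
    (kernelMatrix p q (sparseGrid d τ ∪ A) (sparseGrid d τ ∪ A))⁻¹.submatrix e e =
      Matrix.fromBlocks ((kernelMatrix p q (sparseGrid d τ) (sparseGrid d τ))⁻¹ +
        B * D * B.transpose) (-(B * D)) (-(D * B.transpose)) D := by
  intro e B D
  have hD : ((kernelMatrix p q (sparseGrid d τ ∪ A)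
      (sparseGrid d τ ∪ A))⁻¹.submatrix e e).toBlocks₂₂ = D := by
    ext x y
    rcases eq_or_ne x y with rfl | hne
    · refine Eq.trans ?_ (Matrix.diagonal_apply_eq _ x).symm
      exact hA.inv_kernelMatrix_apply hTM (e (Sum.inr x)) (e (Sum.inr x)) x.2
    · refine Eq.trans ?_ (Matrix.diagonal_apply_ne _ hne).symm
      exact hA.inv_kernelMatrix_eq_zero_of_ne hTM x.2 y.2
        (e.injective.ne (Sum.inr_injective.ne hne))
  rw [← hD]
  exact submatrix_inv_kernelMatrix_union hA.disjoint
    ((isHierarchical_sparseGrid d τ).isUnit_det_kernelMatrix hTM)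
    (hA.isHierarchical.isUnit_det_kernelMatrix hTM)

theorem nnz_inv_add_kriging_le (hTM : IsTMPair p q) :
    let B := krigingMatrix p q (sparseGrid d τ) A
    let D := Matrix.diagonal fun x : A => coefAt p q x x
    nnz ((kernelMatrix p q (sparseGrid d τ) (sparseGrid d τ))⁻¹ + B * D * B.transpose) ≤
      n * 9 ^ d := by
  intro _ _
  let e := Equiv.Finset.union (sparseGrid d τ) A hA.disjoint
  have hE := congrArg Matrix.toBlocks₁₁ (hA.submatrix_inv_kernelMatrix hTM)
  rw [Matrix.toBlocks_fromBlocks₁₁] at hE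
  have hinj : Function.Injective (e ∘ Sum.inl) := e.injective.comp Sum.inl_injective
  calc nnz _ = nnz ((kernelMatrix p q (sparseGrid d τ ∪ A)
          (sparseGrid d τ ∪ A))⁻¹.submatrix (e ∘ Sum.inl) (e ∘ Sum.inl)) := congrArg nnz hE.symm
    _ ≤ _ := nnz_submatrix_le _ hinj hinj
    _ ≤ _ := hA.isHierarchical.nnz_inv_kernelMatrix_le hTM
    _ = n * 9 ^ d := by rw [hA.card_union]

theorem krigingMatrix_mul_diagonal_apply (hTM : IsTMPair p q) (y : sparseGrid d τ) (z : A) :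
    (krigingMatrix p q (sparseGrid d τ) A * Matrix.diagonal fun x : A => coefAt p q x x) y z =
      -coefAt p q z y := by
  have h := congrFun₂ (hA.submatrix_inv_kernelMatrix hTM) (Sum.inl y) (Sum.inr z)
  rw [Matrix.fromBlocks_apply₁₂, Matrix.neg_apply] at h
  let e := Equiv.Finset.union (sparseGrid d τ) A hA.disjoint
  rw [eq_neg_iff_add_eq_zero, add_comm, ← eq_neg_iff_add_eq_zero, ← h]
  exact (hA.inv_kernelMatrix_apply hTM (e (Sum.inl y)) (e (Sum.inr z)) z.2).symm

theorem nnz_krigingMatrix_mul_diagonal_le (hTM : IsTMPair p q) :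
    nnz (krigingMatrix p q (sparseGrid d τ) A * Matrix.diagonal fun x : A => coefAt p q x x) ≤
      A.card * 3 ^ d := by
  have h := nnz_le_of_forall_exists_mem (X := A) (Q := singleton) (b := 1)
    (krigingMatrix p q (sparseGrid d τ) A * Matrix.diagonal fun x : A => coefAt p q x x)
    (fun y z hne => ⟨z, z.2, ?_, Finset.mem_singleton_self _⟩) card_stencilAt_le
    fun x => (Finset.card_singleton x).le
  · rwa [mul_one] at h
  · rw [hA.krigingMatrix_mul_diagonal_apply hTM, neg_ne_zero] at hne
    exact hA.isHierarchical.mem_stencilAt_of_coefAt_ne_zero (Finset.mem_union_left _ y.2) hne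

theorem inv_kernelMatrix_eq_zero (hTM : IsTMPair p q) {l' i' l'' i'' : Fin d → ℕ}
    (hi' : IsIndex l' i') (hi'' : IsIndex l'' i'') (h' : gridPoint l' i' ∈ sparseGrid d τ ∪ A)
    (h'' : gridPoint l'' i'' ∈ sparseGrid d τ ∪ A)
    (h : (gridPoint l' i' ∈ A ∧ gridPoint l'' i'' ∈ A ∧ gridPoint l' i' ≠ gridPoint l'' i'') ∨
      (gridPoint l'' i'' ∈ A ∧ gridPoint l'' i'' ∉ hyperrect l' i') ∨
      ∃ j, 2 ≤ |(i' j : ℤ) * 2 ^ (max (l' j) (l'' j) - l' j) -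
        (i'' j : ℤ) * 2 ^ (max (l' j) (l'' j) - l'' j)|) :
    (kernelMatrix p q (sparseGrid d τ ∪ A) (sparseGrid d τ ∪ A))⁻¹
      ⟨gridPoint l' i', h'⟩ ⟨gridPoint l'' i'', h''⟩ = 0 := by
  rcases h with ⟨hmem', hmem'', hne⟩ | ⟨hmem'', hrect⟩ | hsep
  · exact hA.inv_kernelMatrix_eq_zero_of_ne hTM hmem' hmem'' (mt (congrArg Subtype.val) hne)
  · exact hA.inv_kernelMatrix_eq_zero_of_notMem_hyperrect hTM hi' hi'' h' h'' hmem'' hrect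
  · exact hA.isHierarchical.inv_kernelMatrix_eq_zero_of_two_le_abs_sub hTM hi' hi'' h' h'' hsep

theorem nnz_inv_add_kriging_le_card_add (hTM : IsTMPair p q) :
    let B := krigingMatrix p q (sparseGrid d τ) A
    let D := Matrix.diagonal fun x : A => coefAt p q x x
    (nnz ((kernelMatrix p q (sparseGrid d τ) (sparseGrid d τ))⁻¹ + B * D * B.transpose) : ℝ) ≤
      9 ^ d * ((sparseGrid d τ).card + A.card * (τ : ℝ) ^ (2 * d)) := by
  intro _ _
  have hτ : (1 : ℝ) ≤ (τ : ℝ) ^ (2 * d) := one_le_pow₀ (Nat.one_le_cast.2 hA.one_le_level)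
  calc (nnz _ : ℝ) ≤ n * 9 ^ d := mod_cast hA.nnz_inv_add_kriging_le hTM
    _ = 9 ^ d * ((sparseGrid d τ).card + A.card) := by rw [← hA.card_add, Nat.cast_add, mul_comm]
    _ ≤ 9 ^ d * ((sparseGrid d τ).card + A.card * (τ : ℝ) ^ (2 * d)) := by
        gcongr
        exact le_mul_of_one_le_right (Nat.cast_nonneg _) hτ

theorem nnz_krigingMatrix_mul_diagonal_le_log (hTM : IsTMPair p q) (hd : 1 ≤ d) (hτ : 2 ≤ τ) :
    (nnz (krigingMatrix p q (sparseGrid d τ) A *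
      Matrix.diagonal fun x : A => coefAt p q x x) : ℝ) ≤
      9 ^ d * (A.card * Real.log (sparseGrid d τ).card ^ (d - 1)) := by
  have hcard : 3 ≤ (sparseGrid d τ).card :=
    (Nat.sub_le_sub_right (Nat.pow_le_pow_right two_pos hτ) 1).trans
      (two_pow_sub_one_le_card_sparseGrid hd τ)
  have hlog : 1 ≤ Real.log (sparseGrid d τ).card ^ (d - 1) :=
    one_le_pow₀ (one_le_log_of_three_le (mod_cast hcard))
  calc (nnz _ : ℝ) ≤ A.card * 3 ^ d := mod_cast hA.nnz_krigingMatrix_mul_diagonal_le hTM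
    _ = 3 ^ d * A.card := mul_comm _ _
    _ ≤ 9 ^ d * (A.card * Real.log (sparseGrid d τ).card ^ (d - 1)) := by
        gcongr
        · norm_num
        · exact le_mul_of_one_le_right (Nat.cast_nonneg _) hlog

theorem density_inv_kernelMatrix_le (hTM : IsTMPair p q) (hn : 3 ≤ n) :
    density (kernelMatrix p q (sparseGrid d τ ∪ A) (sparseGrid d τ ∪ A))⁻¹ ≤
      9 ^ d * ((n : ℝ)⁻¹ * Real.log n ^ (2 * d)) := by
  have hn' : (0 : ℝ) < n := Nat.cast_pos.2 (three_pos.trans_le hn)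
  have hlog : 1 ≤ Real.log n ^ (2 * d) := one_le_pow₀ (one_le_log_of_three_le (mod_cast hn))
  have hnnz : (nnz (kernelMatrix p q (sparseGrid d τ ∪ A) (sparseGrid d τ ∪ A))⁻¹ : ℝ) ≤
      n * 9 ^ d := mod_cast hA.card_union ▸ hA.isHierarchical.nnz_inv_kernelMatrix_le hTM
  rw [density, Fintype.card_coe, hA.card_union]
  calc (nnz _ : ℝ) / (n * n) ≤ n * 9 ^ d / (n * n) := by gcongr
    _ = 9 ^ d * (n : ℝ)⁻¹ := by field_simp
    _ ≤ 9 ^ d * ((n : ℝ)⁻¹ * Real.log n ^ (2 * d)) := by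
        gcongr
        exact le_mul_of_one_le_right (inv_nonneg.2 hn'.le) hlog

end IsTSG

end

theorem theorem5_general {d : ℕ} (hd : 1 ≤ d) {p q : Fin d → ℝ → ℝ} (hTM : IsTMPair p q)
    {n τ : ℕ} {A : Finset (Fin d → ℝ)} (hA : IsTSG n τ A) (hn : 3 ≤ n) :
    let S := sparseGrid d τ
    let K := kernelMatrix p q (S ∪ A) (S ∪ A)
    let KS := kernelMatrix p q S S
    let B := KS⁻¹ * kernelMatrix p q S A
    ∃ D : Matrix A A ℝ,
      let E := KS⁻¹ + B * D * B.transpose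
      (IsUnit K.det ∧ IsUnit KS.det ∧ D.IsDiag ∧
        (∀ (l i : Fin d → ℕ) (_ : IsIndex l i) (h : gridPoint l i ∈ A),
          D ⟨gridPoint l i, h⟩ ⟨gridPoint l i, h⟩ = ∏ j, nodeRatio (p j) (q j) (l j) (i j) ∧
            ∀ (H : Type*) [NormedAddCommGroup H] [InnerProductSpace ℝ H] [CompleteSpace H]
              [RKHS ℝ H (UnitCube d) ℝ], HasTMKernel p q H →
              ∃ φ : H, (∀ x : UnitCube d, φ x = basisFun p q l i x.1) ∧
                D ⟨gridPoint l i, h⟩ ⟨gridPoint l i, h⟩ = ‖φ‖ ^ 2) ∧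
        (K⁻¹).submatrix (Equiv.Finset.union S A hA.disjoint)
            (Equiv.Finset.union S A hA.disjoint) =
          Matrix.fromBlocks E (-(B * D)) (-(D * B.transpose)) D) ∧
      (∀ (l' i' l'' i'' : Fin d → ℕ) (_ : IsIndex l' i') (_ : IsIndex l'' i'')
        (h' : gridPoint l' i' ∈ S ∪ A) (h'' : gridPoint l'' i'' ∈ S ∪ A),
        ((gridPoint l' i' ∈ A ∧ gridPoint l'' i'' ∈ A ∧ gridPoint l' i' ≠ gridPoint l'' i'') ∨
          (gridPoint l'' i'' ∈ A ∧ gridPoint l'' i'' ∉ hyperrect l' i') ∨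
          ∃ j, 2 ≤ |(i' j : ℤ) * 2 ^ (max (l' j) (l'' j) - l' j) -
            (i'' j : ℤ) * 2 ^ (max (l' j) (l'' j) - l'' j)|) →
        K⁻¹ ⟨gridPoint l' i', h'⟩ ⟨gridPoint l'' i'', h''⟩ = 0 ∧
          K⁻¹ ⟨gridPoint l'' i'', h''⟩ ⟨gridPoint l' i', h'⟩ = 0) ∧
      ((nnz E : ℝ) ≤ 9 ^ d * ((S.card : ℝ) + (A.card : ℝ) * (τ : ℝ) ^ (2 * d)) ∧
        (2 ≤ τ → (nnz (B * D) : ℝ) ≤ 9 ^ d * ((A.card : ℝ) * Real.log (S.card : ℝ) ^ (d - 1))) ∧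
        density K⁻¹ ≤ 9 ^ d * ((n : ℝ)⁻¹ * Real.log (n : ℝ) ^ (2 * d))) := by
  intro S K KS B
  refine ⟨Matrix.diagonal fun x : A => coefAt p q x x,
    ⟨hA.isHierarchical.isUnit_det_kernelMatrix hTM,
      (isHierarchical_sparseGrid d τ).isUnit_det_kernelMatrix hTM, Matrix.isDiag_diagonal _, ?_,
      hA.submatrix_inv_kernelMatrix hTM⟩, ?_, hA.nnz_inv_add_kriging_le_card_add hTM,
    hA.nnz_krigingMatrix_mul_diagonal_le_log hTM hd, hA.density_inv_kernelMatrix_le hTM hn⟩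
  · intro l i hi h
    rw [Matrix.diagonal_apply_eq, coefAt_gridPoint_self hi]
    exact ⟨rfl, fun H _ _ _ _ hH => hTM.exists_basisFun_mem hi hH⟩
  · intro l' i' l'' i'' hi' hi'' h' h'' h
    have hzero := hA.inv_kernelMatrix_eq_zero hTM hi' hi'' h' h'' h
    exact ⟨hzero, (inv_kernelMatrix_comm _ _).trans hzero⟩

theorem theorem5 {d : ℕ} (hd : 1 ≤ d) (p q : Fin d → ℝ → ℝ)
    (hTM : IsTMPair p q) (hSL : SatisfiesSL p q) :
    ∃ C : ℝ, ∀ (n τ : ℕ) (A : Finset (Fin d → ℝ)) (hA : IsTSG n τ A), 3 ≤ n →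
      let S := sparseGrid d τ
      let K := kernelMatrix p q (S ∪ A) (S ∪ A)
      let KS := kernelMatrix p q S S
      let B := KS⁻¹ * kernelMatrix p q S A
      ∃ D : Matrix A A ℝ,
        let E := KS⁻¹ + B * D * B.transpose
        -- (i) block form of the inverse
        (IsUnit K.det ∧ IsUnit KS.det ∧ D.IsDiag ∧
          (∀ (l i : Fin d → ℕ) (_ : IsIndex l i) (h : gridPoint l i ∈ A),
            D ⟨gridPoint l i, h⟩ ⟨gridPoint l i, h⟩ =
                ∏ j, nodeRatio (p j) (q j) (l j) (i j) ∧
              ∀ (H : Type*) [NormedAddCommGroup H] [InnerProductSpace ℝ H] [CompleteSpace H]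
                [RKHS ℝ H (UnitCube d) ℝ], HasTMKernel p q H →
                ∃ φ : H, (∀ x : UnitCube d, φ x = basisFun p q l i x.1) ∧
                  D ⟨gridPoint l i, h⟩ ⟨gridPoint l i, h⟩ = ‖φ‖ ^ 2) ∧
          (K⁻¹).submatrix (Equiv.Finset.union S A hA.disjoint)
              (Equiv.Finset.union S A hA.disjoint) =
            Matrix.fromBlocks E (-(B * D)) (-(D * B.transpose)) D) ∧
        -- (ii) vanishing entries
        (∀ (l' i' l'' i'' : Fin d → ℕ) (_ : IsIndex l' i') (_ : IsIndex l'' i'')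
          (h' : gridPoint l' i' ∈ S ∪ A) (h'' : gridPoint l'' i'' ∈ S ∪ A),
          ((gridPoint l' i' ∈ A ∧ gridPoint l'' i'' ∈ A ∧ gridPoint l' i' ≠ gridPoint l'' i'') ∨
            (gridPoint l' i' ∈ S ∧ gridPoint l'' i'' ∈ A ∧
              gridPoint l'' i'' ∉ hyperrect l' i') ∨
            (gridPoint l' i' ∈ S ∧ gridPoint l'' i'' ∈ S ∧
              (∃ j, 2 ≤ |(i' j : ℤ) * 2 ^ (max (l' j) (l'' j) - l' j) -
                (i'' j : ℤ) * 2 ^ (max (l' j) (l'' j) - l'' j)|) ∧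
              ∀ x ∈ A, x ∉ hyperrect l' i' ∩ hyperrect l'' i'')) →
          K⁻¹ ⟨gridPoint l' i', h'⟩ ⟨gridPoint l'' i'', h''⟩ = 0 ∧
            K⁻¹ ⟨gridPoint l'' i'', h''⟩ ⟨gridPoint l' i', h'⟩ = 0) ∧
        -- (iii) sparsity
        ((nnz E : ℝ) ≤ C * ((S.card : ℝ) + (A.card : ℝ) * (τ : ℝ) ^ (2 * d)) ∧
          (2 ≤ τ →
            (nnz (B * D) : ℝ) ≤ C * ((A.card : ℝ) * Real.log (S.card : ℝ) ^ (d - 1))) ∧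
          density K⁻¹ ≤ C * ((n : ℝ)⁻¹ * Real.log (n : ℝ) ^ (2 * d))) := by
  refine ⟨9 ^ d, fun _ _ _ hA hn => (theorem5_general hd hTM hA hn).imp fun _ ⟨h₁, h₂, h₃⟩ =>
    ⟨h₁, fun l' i' l'' i'' hi' hi'' h' h'' h => h₂ l' i' l'' i'' hi' hi'' h' h'' ?_, h₃⟩⟩
  exact h.imp_right (Or.imp And.right fun hc => hc.2.2.1)
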